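/- \textbf{Lemma (Lower bounds).} Let $d\ge 1$ be an integer and $p\in(0,1)$. Let $\mathbb L^d=(\mathbb Z^d,\mathbb E^d)$ be the hypercubic lattice, in which two vertices are joined by an edge if and only if their Euclidean distance is $1$. Let each edge in $\mathbb E^d$ be open, independently of the others, with probability $p$; write $\mathbb P$ for the resulting product measure on $\Omega=\{0,1\}^{\mathbb E^d}$, and $\mathcal G^{(\omega)}$ for the graph with vertex set $\mathbb Z^d$ whose edges are the open edges of $\omega\in\Omega$. Let $D^{(\omega)}$ and $A^{(\omega)}$ be the degree operator (multiplication by the vertex degree) and the adjacency operator of $\mathcal G^{(\omega)}$ on the complex Hilbert space $\ell^2(\mathbb Z^d)$, and define the Neumann, Pseudo-Dirichlet and Dirichlet Laplacians $$\Delta_{\mathrm N}^{(\omega)}=D^{(\omega)}-A^{(\omega)},\qquad \Delta_{\tilde{\mathrm D}}^{(\omega)}=\bigl(2d-D^{(\omega)}\bigr)+\Delta_{\mathrm N}^{(\omega)},\qquad \Delta_{\mathrm D}^{(\omega)}=2\bigl(2d-D^{(\omega)}\bigr)+\Delta_{\mathrm N}^{(\omega)}.$$ For $\mathrm X\in\{\mathrm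 N,\tilde{\mathrm D},\mathrm D\}$ let $$N_{\mathrm X}(E)=\int_\Omega \bigl\langle\delta_0,\Theta\bigl(E-\Delta_{\mathrm X}^{(\omega)}\bigr)\delta_0\bigr\rangle\,\mathbb P(d\omega),\qquad E\in\mathbb R,$$ be the integrated density of states, where $\delta_0\in\ell^2(\mathbb Z^d)$ is the unit sequence concentrated at the origin and $\Theta$ is the right-continuous Heaviside function, so that $\Theta(E-\Delta_{\mathrm X}^{(\omega)})$ is the spectral projection of $\Delta_{\mathrm X}^{(\omega)}$ for $(-\infty,E]$. Then there are constants $\alpha_{\mathrm N}^-,\alpha_{\mathrm D}^-\in(0,\infty)$, depending only on $d$ and $p$, such that for every $E\in(0,4d]$ $$N_{\mathrm N}(E)-N_{\mathrm N}(0)\ \ge\ \exp\bigl(-\alpha_{\mathrm N}^-\,E^{-1/2}\bigr)\qquad\text{and}\qquad N_{\tilde{\mathrm D}}(E)\ \ge\ N_{\mathrm D}(E)\ \ge\ \exp\bigl(-\alpha_{\mathrm D}^-\,E^{-d/2}\bigr).$$ -/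

import Mathlib

open MeasureTheory ProbabilityTheory Filter Topology

noncomputable section

namespace BondPercolation

/-! ### Graph Laplacians -/

/-- The complex Hilbert space `ℓ²(V)`. -/
abbrev ell2 (V : Type*) : Type _ := lp (fun _ : V => ℂ) 2

/-- `δ_x`, the sequence concentrated at the point `x`. -/
def delta {V : Type*} [DecidableEq V] (x : V) : ell2 V := lp.single 2 x (1 : ℂ)

section Laplacians

variable {V : Type*} (G : SimpleGraph V) [G.LocallyFinite] {d : ℕ}

/-- `∑_{x ∈ s} |d(x) φ(x)|² ≤ (2d ‖φ‖)²` when all vertex degrees are at most `2d`. -/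
theorem sum_degree_le (hG : ∀ x, G.degree x ≤ 2 * d) (φ : ell2 V) (s : Finset V) :
    ∑ x ∈ s, ‖(G.degree x : ℂ) * φ x‖ ^ (2 : ENNReal).toReal
      ≤ ((2 * d : ℝ) * ‖φ‖) ^ (2 : ENNReal).toReal := by
  have h2 : 0 < (2 : ENNReal).toReal := by norm_num
  have hs := lp.sum_rpow_le_norm_rpow h2 φ s
  simp only [ENNReal.toReal_ofNat, Real.rpow_ofNat] at hs ⊢
  calc ∑ x ∈ s, ‖(G.degree x : ℂ) * φ x‖ ^ 2
      ≤ ∑ x ∈ s, (2 * d : ℝ) ^ 2 * ‖φ x‖ ^ 2 := by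
        refine Finset.sum_le_sum fun x _ => ?_
        rw [norm_mul, mul_pow, Complex.norm_natCast]
        have : (G.degree x : ℝ) ≤ 2 * d := by exact_mod_cast hG x
        gcongr
    _ = (2 * d : ℝ) ^ 2 * ∑ x ∈ s, ‖φ x‖ ^ 2 := by rw [Finset.mul_sum]
    _ ≤ (2 * d : ℝ) ^ 2 * ‖φ‖ ^ 2 := by gcongr
    _ = _ := by ring

/-- `∑_{x ∈ s} |∑_{y ∼ x} φ(y)|² ≤ (2d ‖φ‖)²` when all vertex degrees are at most `2d`. -/
theorem sum_adj_le (hG : ∀ x, G.degree x ≤ 2 * d) (φ : ell2 V) (s : Finset V) :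
    ∑ x ∈ s, ‖∑ y ∈ G.neighborFinset x, φ y‖ ^ (2 : ENNReal).toReal
      ≤ ((2 * d : ℝ) * ‖φ‖) ^ (2 : ENNReal).toReal := by
  classical
  have h2 : 0 < (2 : ENNReal).toReal := by norm_num
  have hs := lp.sum_rpow_le_norm_rpow h2 φ (s.biUnion (fun x => G.neighborFinset x))
  simp only [ENNReal.toReal_ofNat, Real.rpow_ofNat] at hs ⊢
  have hdeg : ∀ x, (G.degree x : ℝ) ≤ 2 * d := fun x => by exact_mod_cast hG x
  calc ∑ x ∈ s, ‖∑ y ∈ G.neighborFinset x, φ y‖ ^ 2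
      ≤ ∑ x ∈ s, (2 * d : ℝ) * ∑ y ∈ G.neighborFinset x, ‖φ y‖ ^ 2 := by
        refine Finset.sum_le_sum fun x _ => ?_
        have h1 : ‖∑ y ∈ G.neighborFinset x, φ y‖ ^ 2
            ≤ (∑ y ∈ G.neighborFinset x, ‖φ y‖) ^ 2 := by
          gcongr
          exact norm_sum_le _ _
        have h3 := sq_sum_le_card_mul_sum_sq (s := G.neighborFinset x) (f := fun y => ‖φ y‖)
        rw [SimpleGraph.card_neighborFinset_eq_degree] at h3
        refine h1.trans (h3.trans ?_)
        exact mul_le_mul_of_nonneg_right (hdeg x) (Finset.sum_nonneg fun _ _ => by positivity)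
    _ = (2 * d : ℝ) * ∑ x ∈ s, ∑ y ∈ G.neighborFinset x, ‖φ y‖ ^ 2 := by rw [Finset.mul_sum]
    _ = (2 * d : ℝ) * ∑ y ∈ s.biUnion (fun x => G.neighborFinset x),
          ∑ x ∈ s.filter (fun x => G.Adj x y), ‖φ y‖ ^ 2 := by
        congr 1
        refine Finset.sum_comm' fun x y => ?_
        simp only [SimpleGraph.mem_neighborFinset, Finset.mem_filter, Finset.mem_biUnion]
        exact ⟨fun h => ⟨h, x, h⟩, fun h => h.1⟩
    _ ≤ (2 * d : ℝ) * ∑ y ∈ s.biUnion (fun x => G.neighborFinset x), (2 * d : ℝ) * ‖φ y‖ ^ 2 := by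
        gcongr with y _
        rw [Finset.sum_const, nsmul_eq_mul]
        refine mul_le_mul_of_nonneg_right (le_trans ?_ (hdeg y)) (by positivity)
        rw [← SimpleGraph.card_neighborFinset_eq_degree]
        exact_mod_cast Finset.card_le_card fun x hx => by
          simpa [SimpleGraph.adj_comm] using (Finset.mem_filter.1 hx).2
    _ = (2 * d : ℝ) ^ 2 * ∑ y ∈ s.biUnion (fun x => G.neighborFinset x), ‖φ y‖ ^ 2 := by
        rw [← Finset.mul_sum]; ring
    _ ≤ (2 * d : ℝ) ^ 2 * ‖φ‖ ^ 2 := by gcongr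
    _ = _ := by ring

/-- The degree operator, `[D(G) φ](x) = d_G(x) φ(x)`, of a graph whose vertex degrees are at most
`2d`. -/
def degreeOp (hG : ∀ x, G.degree x ≤ 2 * d) : ell2 V →L[ℂ] ell2 V :=
  LinearMap.mkContinuous
    { toFun := fun φ => ⟨fun x => (G.degree x : ℂ) * φ x, memℓp_gen' (sum_degree_le G hG φ)⟩
      map_add' := fun φ ψ => by ext x; exact mul_add _ _ _
      map_smul' := fun c φ => by ext x; simp [mul_left_comm] }
    (2 * d) (fun φ => lp.norm_le_of_forall_sum_le (by norm_num) (by positivity)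
      (sum_degree_le G hG φ))

/-- The adjacency operator, `[A(G) φ](x) = ∑_{y ∼ x} φ(y)`, of a graph whose vertex degrees are at
most `2d`. -/
def adjacencyOp (hG : ∀ x, G.degree x ≤ 2 * d) : ell2 V →L[ℂ] ell2 V :=
  LinearMap.mkContinuous
    { toFun := fun φ => ⟨fun x => ∑ y ∈ G.neighborFinset x, φ y, memℓp_gen' (sum_adj_le G hG φ)⟩
      map_add' := fun φ ψ => by ext x; exact Finset.sum_add_distrib
      map_smul' := fun c φ => by ext x; simp [Finset.mul_sum] }
    (2 * d) (fun φ => lp.norm_le_of_forall_sum_le (by norm_num) (by positivity)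
      (sum_adj_le G hG φ))

@[simp] theorem degreeOp_apply (hG : ∀ x, G.degree x ≤ 2 * d) (φ : ell2 V) (x : V) :
    degreeOp G hG φ x = (G.degree x : ℂ) * φ x := rfl

@[simp] theorem adjacencyOp_apply (hG : ∀ x, G.degree x ≤ 2 * d) (φ : ell2 V) (x : V) :
    adjacencyOp G hG φ x = ∑ y ∈ G.neighborFinset x, φ y := rfl

/-- The three boundary conditions: Neumann, Pseudo-Dirichlet and Dirichlet. -/
inductive BoundaryCondition
  | neumann
  | pseudoDirichlet
  | dirichlet

/-- The Laplacians `Δ_N = D - A`, `Δ_D̃ = (2d - D) + Δ_N` and `Δ_D = 2 (2d - D) + Δ_N` of a graph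
whose vertex degrees are at most `2d`. -/
def laplacian (hG : ∀ x, G.degree x ≤ 2 * d) : BoundaryCondition → (ell2 V →L[ℂ] ell2 V)
  | .neumann => degreeOp G hG - adjacencyOp G hG
  | .pseudoDirichlet =>
      ((2 * d : ℂ) • ContinuousLinearMap.id ℂ (ell2 V) - degreeOp G hG)
        + (degreeOp G hG - adjacencyOp G hG)
  | .dirichlet =>
      (2 : ℂ) • ((2 * d : ℂ) • ContinuousLinearMap.id ℂ (ell2 V) - degreeOp G hG)
        + (degreeOp G hG - adjacencyOp G hG)

theorem isSelfAdjoint_degreeOp (hG : ∀ x, G.degree x ≤ 2 * d) :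
    IsSelfAdjoint (degreeOp G hG) := by
  rw [ContinuousLinearMap.isSelfAdjoint_iff_isSymmetric]
  intro φ ψ
  simp only [ContinuousLinearMap.coe_coe, lp.inner_eq_tsum, degreeOp_apply]
  refine tsum_congr fun x => ?_
  simp [mul_left_comm, mul_assoc]

theorem isSelfAdjoint_adjacencyOp (hG : ∀ x, G.degree x ≤ 2 * d) :
    IsSelfAdjoint (adjacencyOp G hG) := by
  classical
  rw [ContinuousLinearMap.isSelfAdjoint_iff', ContinuousLinearMap.ext_iff]
  -- matrix elements
  have key : ∀ x y : V, inner ℂ (delta x) (adjacencyOp G hG (delta y))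
      = if G.Adj x y then (1 : ℂ) else 0 := by
    intro x y
    simp only [delta, lp.inner_single_left, adjacencyOp_apply, lp.single_apply]
    simp [Pi.single_apply, SimpleGraph.mem_neighborFinset]
  intro φ
  have hφ := lp.hasSum_single (E := fun _ : V => ℂ) (p := 2) (by norm_num) φ
  have hcoe : ∀ (S : ell2 V →L[ℂ] ell2 V), HasSum (fun y => φ y • S (delta y)) (S φ) := by
    intro S
    have := hφ.mapL S
    convert this using 2 with y
    rw [← map_smul]
    congr 1
    ext z
    by_cases h : z = y
    · subst h; simp [delta]
    · simp [delta, lp.single_apply, h]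
  have hbasis : ∀ y, ContinuousLinearMap.adjoint (adjacencyOp G hG) (delta y)
      = adjacencyOp G hG (delta y) := by
    intro y
    ext x
    have e : ∀ ψ : ell2 V, inner ℂ (delta x) ψ = ψ x := by
      intro ψ; simp [delta, lp.inner_single_left]
    rw [← e, ← e, ContinuousLinearMap.adjoint_inner_right, ← inner_conj_symm, key, key]
    simp [SimpleGraph.adj_comm, apply_ite]
  refine (hcoe _).unique ?_
  simpa only [hbasis] using hcoe (adjacencyOp G hG)

theorem isSelfAdjoint_laplacian (hG : ∀ x, G.degree x ≤ 2 * d) (X : BoundaryCondition) :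
    IsSelfAdjoint (laplacian G hG X) := by
  have hD := isSelfAdjoint_degreeOp G hG
  have hA := isSelfAdjoint_adjacencyOp G hG
  have h1 : IsSelfAdjoint ((2 * d : ℂ) • ContinuousLinearMap.id ℂ (ell2 V)) := by
    refine IsSelfAdjoint.smul ?_ (IsSelfAdjoint.one _)
    simp [isSelfAdjoint_iff]
  cases X with
  | neumann => exact hD.sub hA
  | pseudoDirichlet => exact (h1.sub hD).add (hD.sub hA)
  | dirichlet =>
    refine IsSelfAdjoint.add (IsSelfAdjoint.smul ?_ (h1.sub hD)) (hD.sub hA)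
    simp

end Laplacians

/-! ### Spectral projections -/

section Spectral

variable {H : Type*} [NormedAddCommGroup H] [InnerProductSpace ℂ H] [CompleteSpace H]

/-- `Θ(E - T)` for a bounded self-adjoint operator `T`, where `Θ` is the right-continuous Heaviside
function, that is, the spectral projection of `T` for `]-∞, E]`.  As `Θ(E - ·)` is the indicator
function of the zero set of the continuous function `t ↦ max (t - E) 0`, it is the orthogonal
projection onto the kernel of `max (T - E) 0`. -/
def heavisideOp (T : H →L[ℂ] H) (E : ℝ) : H →L[ℂ] H :=
  (cfc (fun t : ℝ => max (t - E) 0) T : H →L[ℂ] H).ker.starProjection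

/-- Continuous functions decreasing pointwise to `t ↦ Θ(E - t)`. -/
def ramp (E : ℝ) (n : ℕ) (t : ℝ) : ℝ := 1 - max (t - E) 0 / max (t - E) (1 / (n + 1))

/-- `Θ(E - T)` is the value of the (strongly sequentially continuous) functional calculus at
`Θ(E - ·)`. -/
theorem tendsto_cfc_ramp (T : H →L[ℂ] H) (hT : IsSelfAdjoint T) (E : ℝ) (φ : H) :
    Tendsto (fun n => cfc (ramp E n) T φ) atTop (𝓝 (heavisideOp T E φ)) := by
  set g : ℝ → ℝ := fun t => max (t - E) 0 with hg
  set Q : H →L[ℂ] H := cfc g T with hQ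
  have hgc : Continuous g := by fun_prop
  have hpos : ∀ (n : ℕ) (t : ℝ), 0 < max (t - E) (1 / ((n : ℝ) + 1)) := fun n t =>
    lt_max_of_lt_right (by positivity)
  have hhc : ∀ n : ℕ, Continuous fun t => (max (t - E) (1 / ((n : ℝ) + 1)))⁻¹ := fun n =>
    Continuous.inv₀ (by fun_prop) fun t => (hpos n t).ne'
  have hrc : ∀ n, Continuous (ramp E n) := fun n => by
    unfold ramp
    simp only [div_eq_mul_inv _ (max _ _)]
    exact continuous_const.sub (Continuous.mul (by fun_prop) (hhc n))
  have hr01 : ∀ n t, 0 ≤ ramp E n t ∧ ramp E n t ≤ 1 := fun n t => by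
    have h1 : max (t - E) 0 / max (t - E) (1 / ((n : ℝ) + 1)) ≤ 1 :=
      (div_le_one (hpos n t)).2 (max_le_max le_rfl (by positivity))
    have h0 : 0 ≤ max (t - E) 0 / max (t - E) (1 / ((n : ℝ) + 1)) :=
      div_nonneg (le_max_right _ _) (hpos n t).le
    unfold ramp
    constructor <;> linarith
  have hnorm : ∀ n, ‖(cfc (ramp E n) T : H →L[ℂ] H)‖ ≤ 1 := fun n =>
    norm_cfc_le zero_le_one fun t _ => by
      rw [Real.norm_of_nonneg (hr01 n t).1]; exact (hr01 n t).2
  -- on the kernel of `Q`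
  have hker : ∀ ψ, Q ψ = 0 → ∀ n, cfc (ramp E n) T ψ = ψ := by
    intro ψ hψ n
    have : cfc (ramp E n) T
        = 1 - cfc (fun t => (max (t - E) (1 / ((n : ℝ) + 1)))⁻¹) T * Q := by
      rw [hQ, ← cfc_mul _ _ T (hhc n).continuousOn hgc.continuousOn, ← cfc_const_one ℝ T,
        ← cfc_sub (fun _ => (1 : ℝ)) (fun t => (max (t - E) (1 / ((n : ℝ) + 1)))⁻¹ * g t) T
          continuousOn_const ((hhc n).mul hgc).continuousOn]
      refine cfc_congr fun t _ => ?_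
      simp [ramp, hg, div_eq_inv_mul]
    rw [this]
    simp [hψ]
  -- on the range of `Q`
  have hran : ∀ ψ n, ‖cfc (ramp E n) T (Q ψ)‖ ≤ 1 / ((n : ℝ) + 1) * ‖ψ‖ := by
    intro ψ n
    have : ‖cfc (ramp E n) T * Q‖ ≤ 1 / ((n : ℝ) + 1) := by
      rw [hQ, ← cfc_mul _ _ T (hrc n).continuousOn hgc.continuousOn]
      refine norm_cfc_le (by positivity) fun t _ => ?_
      have hg0 : 0 ≤ g t := le_max_right _ _
      rw [Real.norm_of_nonneg (mul_nonneg (hr01 n t).1 hg0)]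
      rcases le_total (t - E) (1 / ((n : ℝ) + 1)) with h | h
      · calc ramp E n t * g t ≤ 1 * (1 / ((n : ℝ) + 1)) :=
              mul_le_mul (hr01 n t).2 (max_le h (by positivity)) hg0 zero_le_one
          _ = _ := one_mul _
      · have h0 : 0 < t - E := lt_of_lt_of_le (by positivity) h
        have : ramp E n t = 0 := by
          rw [ramp, max_eq_left h, max_eq_left h0.le, div_self h0.ne', sub_self]
        rw [this, zero_mul]
        positivity
    exact (cfc (ramp E n) T * Q).le_of_opNorm_le this ψ
  -- on the closure of the range of `Q`
  have hQsa : ContinuousLinearMap.adjoint Q = Q :=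
    ContinuousLinearMap.isSelfAdjoint_iff'.1 (cfc_predicate g T)
  have hperp : ∀ χ ∈ Q.kerᗮ,
      Tendsto (fun n => cfc (ramp E n) T χ) atTop (𝓝 0) := by
    intro χ hχ
    have hχ' : χ ∈ closure (Set.range Q) := by
      have h := ContinuousLinearMap.orthogonal_ker Q
      rw [hQsa] at h
      rw [h] at hχ
      exact hχ
    rw [Metric.tendsto_atTop]
    intro ε hε
    obtain ⟨_, ⟨ψ, rfl⟩, hψ⟩ := Metric.mem_closure_iff.1 hχ' (ε / 2) (by positivity)
    have hlim : Tendsto (fun n : ℕ => 1 / ((n : ℝ) + 1) * ‖ψ‖) atTop (𝓝 0) := by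
      simpa using tendsto_one_div_add_atTop_nhds_zero_nat.mul_const ‖ψ‖
    obtain ⟨N, hN⟩ := (hlim.eventually (gt_mem_nhds (half_pos hε))).exists_forall_of_atTop
    refine ⟨N, fun n hn => ?_⟩
    rw [dist_zero_right]
    calc ‖cfc (ramp E n) T χ‖
        = ‖cfc (ramp E n) T (χ - Q ψ) + cfc (ramp E n) T (Q ψ)‖ := by rw [map_sub]; simp
      _ ≤ ‖cfc (ramp E n) T (χ - Q ψ)‖ + ‖cfc (ramp E n) T (Q ψ)‖ := norm_add_le _ _
      _ ≤ 1 * ‖χ - Q ψ‖ + 1 / ((n : ℝ) + 1) * ‖ψ‖ :=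
          add_le_add (ContinuousLinearMap.le_of_opNorm_le _ (hnorm n) _) (hran ψ n)
      _ < ε / 2 + ε / 2 := by
          rw [one_mul, ← dist_eq_norm]
          exact add_lt_add hψ (hN n hn)
      _ = ε := add_halves ε
  have hdec : ∀ n, cfc (ramp E n) T φ
      = heavisideOp T E φ + cfc (ramp E n) T (φ - heavisideOp T E φ) := by
    intro n
    have hm : Q (heavisideOp T E φ) = 0 :=
      LinearMap.mem_ker.1 (Submodule.starProjection_apply_mem Q.ker φ)
    rw [map_sub, hker _ hm n]
    abel
  simp_rw [hdec]
  have hlim := (hperp (φ - heavisideOp T E φ)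
    (Submodule.sub_starProjection_mem_orthogonal φ)).const_add (heavisideOp T E φ)
  rwa [add_zero] at hlim

end Spectral

/-! ### Bond percolation on the hypercubic lattice -/

/-- The simple hypercubic lattice `𝕃^d`: two vertices of `ℤ^d` are adjacent when their Euclidean
distance (equivalently, its square) is `1`. -/
def lattice (d : ℕ) : SimpleGraph (Fin d → ℤ) where
  Adj x y := ∑ i, (x i - y i) ^ 2 = 1
  symm := ⟨fun x y h => by
    rw [← h]
    exact Finset.sum_congr rfl fun i _ => by ring⟩
  loopless := ⟨fun x h => by simp at h⟩

/-- The probability space `Ω = {0,1}^{𝔼^d}` with its product sigma-algebra. -/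
abbrev Config (d : ℕ) : Type := (lattice d).edgeSet → Bool

/-- The law under which the edges are independently open (`true`) with probability `p`. -/
def percLaw (d : ℕ) (p : unitInterval) : Measure (Config d) :=
  Measure.infinitePi fun _ => bernoulliMeasure true false p

/-- The bond-percolation graph `G^(ω)`: vertex set `ℤ^d` and the open edges. -/
def percGraph {d : ℕ} (ω : Config d) : SimpleGraph (Fin d → ℤ) :=
  SimpleGraph.fromEdgeSet {e | ∃ h : e ∈ (lattice d).edgeSet, ω ⟨e, h⟩ = true}

theorem percGraph_le {d : ℕ} (ω : Config d) : percGraph ω ≤ lattice d := by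
  intro x y h
  obtain ⟨⟨h, -⟩, -⟩ := (SimpleGraph.fromEdgeSet_adj _).1 h
  exact h

/-- The `2d` nearest neighbours of a vertex. -/
theorem lattice_neighborSet_subset {d : ℕ} (x : Fin d → ℤ) :
    (lattice d).neighborSet x ⊆ ((Finset.univ ×ˢ ({1, -1} : Finset ℤ)).image
      fun q : Fin d × ℤ => x + Pi.single q.1 q.2 : Finset (Fin d → ℤ)) := by
  intro y hy
  replace hy : ∑ i, (x i - y i) ^ 2 = 1 := hy
  obtain ⟨i, hi⟩ : ∃ i, x i ≠ y i := by
    by_contra! h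
    simp [h] at hy
  rw [← Finset.add_sum_erase _ _ (Finset.mem_univ i)] at hy
  have h1 : 0 < (x i - y i) ^ 2 := by have := sub_ne_zero.2 hi; positivity
  have h2 : 0 ≤ ∑ j ∈ Finset.univ.erase i, (x j - y j) ^ 2 :=
    Finset.sum_nonneg fun _ _ => sq_nonneg _
  have h3 : ∑ j ∈ Finset.univ.erase i, (x j - y j) ^ 2 = 0 := by omega
  have h4 : (x i - y i) ^ 2 = 1 := by omega
  have h5 : ∀ j, j ≠ i → y j = x j := fun j hj => by
    have := (Finset.sum_eq_zero_iff_of_nonneg fun _ _ => sq_nonneg _).1 h3 j (by simp [hj])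
    have := pow_eq_zero_iff (two_ne_zero) |>.1 this
    omega
  have h6 : y i - x i = 1 ∨ y i - x i = -1 := by
    rcases sq_eq_one_iff.1 h4 with h | h <;> omega
  simp only [Finset.coe_image, Set.mem_image, Finset.mem_coe, Finset.mem_product,
    Finset.mem_univ, true_and, Finset.mem_insert, Finset.mem_singleton]
  refine ⟨(i, y i - x i), h6, ?_⟩
  ext j
  by_cases h : j = i
  · subst h; simp
  · simp [h, h5 j h]

instance {d : ℕ} (ω : Config d) : (percGraph ω).LocallyFinite := fun x =>
  ((Finset.finite_toSet _).subset
    (fun _ h => lattice_neighborSet_subset x (percGraph_le ω h))).fintype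

theorem percGraph_degree_le {d : ℕ} (ω : Config d) (x : Fin d → ℤ) :
    (percGraph ω).degree x ≤ 2 * d := by
  rw [← SimpleGraph.card_neighborFinset_eq_degree]
  have hsub : (percGraph ω).neighborFinset x ⊆
      (Finset.univ ×ˢ ({1, -1} : Finset ℤ)).image
        fun q : Fin d × ℤ => x + Pi.single q.1 q.2 := fun y hy =>
    lattice_neighborSet_subset x (percGraph_le ω ((SimpleGraph.mem_neighborFinset _ _ _).1 hy))
  refine (Finset.card_le_card hsub).trans (Finset.card_image_le.trans ?_)
  simp [mul_comm]

/-- The Laplacian `Δ_X^(ω)` on the bond-percolation graph. -/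
def percLaplacian {d : ℕ} (X : BoundaryCondition) (ω : Config d) :
    ell2 (Fin d → ℤ) →L[ℂ] ell2 (Fin d → ℤ) :=
  laplacian (percGraph ω) (percGraph_degree_le ω) X

/-- The integrated density of states
`N_X(E) = ∫ ℙ(dω) ⟨δ₀, Θ(E - Δ_X^(ω)) δ₀⟩`. The inner product is real, being that of a vector with
its image under an orthogonal projection. -/
def ids (d : ℕ) (p : unitInterval) (X : BoundaryCondition) (E : ℝ) : ℝ :=
  ∫ ω, (inner ℂ (delta 0) (heavisideOp (percLaplacian X ω) E (delta 0))).re ∂(percLaw d p)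

end BondPercolation

end

/-! The lower bounds come from rare isolated clusters. If all edges inside a finite set S containing
0 are open and all edges leaving S are closed, an eigenvector v on S, extended by zero, is an
eigenvector of the full Laplacian. By Cauchy–Schwarz it contributes at least |v(0)|²/‖v‖² to the
diagonal element at 0 of the spectral projection. The event prescribes at most 2d|S| edges, so its
probability is at least q^(2d|S|), where q = min(p, 1 - p) (`exists_subset_isolated`).

For Neumann, S is a chain of n vertices carrying the first nonconstant cosine mode; its eigenvalue 2
- 2cos(π/n) is positive, hence not counted at energy 0, and at most π²/n². For Dirichlet, S is a
cube of side n carrying a product of sines, with eigenvalue at most dπ²/n². With n of order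
E^(-1/2), |S| is of order E^(-1/2), respectively E^(-d/2), and the polynomial prefactors are
absorbed into the exponentials.

The comparison of the two Dirichlet-type operators needs more, since Δ_D̃ ≤ Δ_D does not order the
spectral projections. It only says that the range of P = Θ(E - Δ_D) meets the kernel of Q = Θ(E -
Δ_D̃) in 0 (`spectralSubspace_inf_orthogonal`). The averaged diagonal element τ(T) = 𝔼⟨δ₀, T δ₀⟩ is
a trace on translation covariant families (`integral_mul_comm`). Hence τ((1 - PQP)^k) = τ((1 -
QPQ)^k) ≥ τ(1 - Q) for all k, while by the mean ergodic theorem the averages over k of (1 - PQP)^k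
converge strongly to 1 - P. In the limit τ(1 - P) ≥ τ(1 - Q), that is, τ(P) ≤ τ(Q)
(`integral_starProjection_le`). -/

noncomputable section

namespace BondPercolation

/-! ### Spectral subspaces and functional calculus of self-adjoint operators -/

section HilbertSpace

variable {H : Type*} [NormedAddCommGroup H] [InnerProductSpace ℂ H]

/-- If `v` lies in `K'` and is orthogonal to `K ≤ K'`, the projections onto `K'` and `K` differ at
least by the projection onto `v`. -/
theorem le_inner_starProjection_sub {K K' : Submodule ℂ H} [K.HasOrthogonalProjection]
    [K'.HasOrthogonalProjection] (hK : K ≤ K') {v : H} (hv : v ∈ K')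
    (hv' : ∀ w ∈ K, inner ℂ v w = 0) (φ : H) :
    ‖(inner ℂ v φ : ℂ)‖ ^ 2 ≤ ‖v‖ ^ 2 * ((inner ℂ φ (K'.starProjection φ)).re
      - (inner ℂ φ (K.starProjection φ)).re) := by
  set a := K'.starProjection φ with ha
  set b := K.starProjection φ with hb
  have haK : a ∈ K' := Submodule.starProjection_apply_mem _ _
  have hbK : b ∈ K := Submodule.starProjection_apply_mem _ _
  have o1 : ∀ w ∈ K', inner ℂ w φ = inner ℂ w a := fun w hw => by
    rw [← sub_eq_zero, ← inner_sub_right]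
    exact Submodule.sub_starProjection_mem_orthogonal (K := K') φ w hw
  have o2 : ∀ w ∈ K, inner ℂ w φ = inner ℂ w b := fun w hw => by
    rw [← sub_eq_zero, ← inner_sub_right]
    exact Submodule.sub_starProjection_mem_orthogonal (K := K) φ w hw
  have e1 : (inner ℂ v φ : ℂ) = inner ℂ v (a - b) := by
    rw [inner_sub_right, hv' b hbK, sub_zero, o1 v hv]
  have e2 : (inner ℂ φ a).re - (inner ℂ φ b).re = ‖a - b‖ ^ 2 := by
    have e3 : (inner ℂ φ a).re = ‖a‖ ^ 2 := by
      rw [← inner_conj_symm, o1 a haK, Complex.conj_re]; exact inner_self_eq_norm_sq (𝕜 := ℂ) a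
    have e4 : (inner ℂ φ b).re = ‖b‖ ^ 2 := by
      rw [← inner_conj_symm, o2 b hbK, Complex.conj_re]; exact inner_self_eq_norm_sq (𝕜 := ℂ) b
    have e5 : (inner ℂ a b).re = ‖b‖ ^ 2 := by
      rw [← inner_conj_symm, ← o1 b (hK hbK), o2 b hbK, Complex.conj_re]
      exact inner_self_eq_norm_sq (𝕜 := ℂ) b
    have e6 := norm_sub_sq (𝕜 := ℂ) a b
    change _ = _ - 2 * (inner ℂ a b).re + _ at e6
    rw [e6, e3, e4, e5]; ring
  rw [e1, e2, ← mul_pow]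
  exact pow_le_pow_left₀ (norm_nonneg _) (norm_inner_le_norm _ _) 2

/-- The value `q(T)` of a real polynomial. -/
def polynomialOp (q : Polynomial ℝ) (T : H →L[ℂ] H) : H →L[ℂ] H := Polynomial.aeval T q

theorem polynomialOp_add (q r : Polynomial ℝ) (T : H →L[ℂ] H) :
    polynomialOp (q + r) T = polynomialOp q T + polynomialOp r T := map_add _ _ _

theorem polynomialOp_monomial (n : ℕ) (a : ℝ) (T : H →L[ℂ] H) :
    polynomialOp (Polynomial.monomial n a) T = (a : ℂ) • T ^ n := by
  ext v
  simp [polynomialOp, Polynomial.aeval_monomial, Algebra.algebraMap_eq_smul_one]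

variable [CompleteSpace H]

/-- A Lipschitz function of a self-adjoint operator acts on eigenvectors by evaluation. -/
theorem cfc_apply_eigenvector {T : H →L[ℂ] H} (hT : IsSelfAdjoint T) {g : ℝ → ℝ}
    (hg : Continuous g) {l : ℝ} (hl : ∀ t, |g t - g l| ≤ |t - l|) {v : H}
    (hv : T v = (l : ℂ) • v) : cfc g T v = (g l : ℂ) • v := by
  -- The squared Lipschitz bound gives (g(T) - g(l))² ≤ (T - l)², and the right-hand side
  -- annihilates `v`.
  have h1 : cfc (fun t => (g t - g l) ^ 2) T ≤ cfc (fun t => (t - l) ^ 2) T :=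
    cfc_mono fun t _ => sq_le_sq.2 (hl t)
  have e1 : cfc (fun t => (g t - g l) ^ 2) T = (cfc g T - algebraMap ℝ _ (g l)) ^ 2 := by
    rw [cfc_pow _ 2 T (by fun_prop), cfc_sub g (fun _ => g l) T, cfc_const _ T hT]
  have e2 : cfc (fun t => (t - l) ^ 2) T = (T - algebraMap ℝ _ l) ^ 2 := by
    rw [cfc_pow _ 2 T (by fun_prop), cfc_sub (fun t => t) (fun _ => l) T, cfc_const _ T hT,
      cfc_id' ℝ T]
  rw [e1, e2, ContinuousLinearMap.le_def] at h1
  have h2 := h1.re_inner_nonneg_left v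
  have h3 : (T - algebraMap ℝ (H →L[ℂ] H) l) v = 0 := by
    simp [Algebra.algebraMap_eq_smul_one, hv]
  have hsa : IsSelfAdjoint (cfc g T - algebraMap ℝ (H →L[ℂ] H) (g l)) :=
    (cfc_predicate g T).sub (IsSelfAdjoint.algebraMap _ (IsSelfAdjoint.all _))
  rw [ContinuousLinearMap.isSelfAdjoint_iff_isSymmetric] at hsa
  set R := cfc g T - algebraMap ℝ (H →L[ℂ] H) (g l) with hR
  have h4 : R v = 0 := by
    simp only [sq, sub_apply, mul_apply_eq_comp, h3, map_zero,
      zero_sub, inner_neg_left] at h2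
    have h5 := hsa (R v) v
    simp only [ContinuousLinearMap.coe_coe] at h5
    rw [h5, map_neg, inner_self_eq_norm_sq] at h2
    have : ‖R v‖ = 0 := by nlinarith [norm_nonneg (R v)]
    simpa using this
  rw [hR] at h4
  simpa [Algebra.algebraMap_eq_smul_one, sub_eq_zero] using h4

/-- Writing T = S*S turns the quadratic form into ‖S v‖². -/
theorem apply_eq_zero_of_re_inner_le_zero {T : H →L[ℂ] H} (hT : 0 ≤ T) {v : H}
    (hv : RCLike.re (inner ℂ (T v) v) ≤ 0) : T v = 0 := by
  obtain ⟨S, rfl⟩ := CStarAlgebra.nonneg_iff_eq_star_mul_self.1 hT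
  rw [mul_apply_eq_comp, ContinuousLinearMap.star_eq_adjoint,
    ContinuousLinearMap.adjoint_inner_left, inner_self_eq_norm_sq] at hv
  have h : S v = 0 := by
    have : ‖S v‖ = 0 := by nlinarith [norm_nonneg (S v)]
    simpa using this
  rw [mul_apply_eq_comp, h, map_zero]

theorem abs_posPart_sub_le (E t l : ℝ) : |max (t - E) 0 - max (l - E) 0| ≤ |t - l| := by
  have := abs_max_sub_max_le_abs (t - E) (l - E) 0
  simpa using this

/-- The kernel of `(T - E)₊`, on which `Θ(E - T)` projects. -/
def spectralSubspace (T : H →L[ℂ] H) (E : ℝ) : Submodule ℂ H :=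
  (cfc (fun t : ℝ => max (t - E) 0) T : H →L[ℂ] H).ker

instance (T : H →L[ℂ] H) (E : ℝ) : (spectralSubspace T E).HasOrthogonalProjection :=
  inferInstanceAs ((cfc (fun t : ℝ => max (t - E) 0) T : H →L[ℂ] H).ker.HasOrthogonalProjection)

theorem heavisideOp_eq (T : H →L[ℂ] H) (E : ℝ) :
    heavisideOp T E = (spectralSubspace T E).starProjection := rfl

theorem mem_spectralSubspace {T : H →L[ℂ] H} {E : ℝ} {v : H} :
    v ∈ spectralSubspace T E ↔ cfc (fun t : ℝ => max (t - E) 0) T v = 0 := Iff.rfl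

theorem mem_spectralSubspace_of_eigenvector {T : H →L[ℂ] H} (hT : IsSelfAdjoint T) {E l : ℝ}
    (hl : l ≤ E) {v : H} (hv : T v = (l : ℂ) • v) : v ∈ spectralSubspace T E := by
  rw [mem_spectralSubspace, cfc_apply_eigenvector hT (by fun_prop)
    (fun t => abs_posPart_sub_le E t l) hv]
  simp [hl]

/-- The positive part of T - E multiplies `v` by l - E ≠ 0 and kills `w`; symmetry then forces
orthogonality. -/
theorem inner_eq_zero_of_eigenvector {T : H →L[ℂ] H} (hT : IsSelfAdjoint T) {E l : ℝ}
    (hl : E < l) {v w : H} (hv : T v = (l : ℂ) • v) (hw : w ∈ spectralSubspace T E) :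
    inner ℂ v w = 0 := by
  have h1 := cfc_apply_eigenvector hT (g := fun t => max (t - E) 0) (by fun_prop)
    (fun t => abs_posPart_sub_le E t l) hv
  have hsa : IsSelfAdjoint (cfc (fun t => max (t - E) 0) T) := cfc_predicate _ T
  rw [ContinuousLinearMap.isSelfAdjoint_iff_isSymmetric] at hsa
  have h2 := hsa v w
  simp only [ContinuousLinearMap.coe_coe] at h2
  rw [h1, mem_spectralSubspace.1 hw, inner_zero_right, inner_smul_left] at h2
  have h3 : l - E ≠ 0 := (sub_pos.2 hl).ne'
  rcases mul_eq_zero.1 h2 with h | h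
  · rw [Complex.conj_ofReal, Complex.ofReal_eq_zero, max_eq_left (sub_pos.2 hl).le] at h
    exact absurd h h3
  · exact h

theorem spectralSubspace_mono (T : H →L[ℂ] H) {E E' : ℝ} (h : E ≤ E') :
    spectralSubspace T E ≤ spectralSubspace T E' := by
  intro v hv
  rw [mem_spectralSubspace] at hv ⊢
  have h1 : cfc (fun t => max (t - E') 0) T ≤ cfc (fun t => max (t - E) 0) T :=
    cfc_mono fun t _ => max_le_max (by linarith) le_rfl
  have h0 : 0 ≤ cfc (fun t => max (t - E') 0) T := cfc_nonneg fun t _ => le_max_right _ _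
  rw [ContinuousLinearMap.le_def] at h1
  have h2 := h1.re_inner_nonneg_left v
  rw [sub_apply, hv, zero_sub, inner_neg_left, map_neg] at h2
  exact apply_eq_zero_of_re_inner_le_zero h0 (by linarith)

/-- If `A ≤ B`, then no nonzero vector of the spectral subspace of `B` for `]-∞, E]` is orthogonal
to that of `A`. -/
theorem spectralSubspace_inf_orthogonal {A B : H →L[ℂ] H} (hA : IsSelfAdjoint A)
    (hB : IsSelfAdjoint B) (hAB : A ≤ B) (E : ℝ) :
    spectralSubspace B E ⊓ (spectralSubspace A E)ᗮ = ⊥ := by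
  rw [eq_bot_iff]
  rintro v ⟨hv, hv'⟩
  have hdec : ∀ T : H →L[ℂ] H, IsSelfAdjoint T → T - algebraMap ℝ _ E
      = cfc (fun t => max (t - E) 0) T - cfc (fun t => max (E - t) 0) T := by
    intro T hT
    rw [← cfc_sub (fun t => max (t - E) 0) (fun t => max (E - t) 0) T]
    have : (fun t : ℝ => max (t - E) 0 - max (E - t) 0) = fun t => t - E := by
      funext t
      rcases le_total t E with h | h
      · rw [max_eq_right (by linarith), max_eq_left (by linarith)]; ring
      · rw [max_eq_left (by linarith), max_eq_right (by linarith)]; ring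
    rw [this, cfc_sub (fun t => t) (fun _ => E) T, cfc_const _ T hT, cfc_id' ℝ T]
  have hneg : ∀ T : H →L[ℂ] H, 0 ≤ cfc (fun t => max (E - t) 0) T := fun T =>
    cfc_nonneg fun t _ => le_max_right _ _
  have hpos : 0 ≤ cfc (fun t => max (t - E) 0) A := cfc_nonneg fun t _ => le_max_right _ _
  -- the negative part of `A - E` maps into the spectral subspace
  have h1 : inner ℂ (cfc (fun t => max (E - t) 0) A v) v = 0 := by
    refine hv' _ ?_
    rw [mem_spectralSubspace, ← mul_apply_eq_comp, ← cfc_mul _ _ A]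
    have : (fun t : ℝ => max (t - E) 0 * max (E - t) 0) = fun _ => 0 := by
      funext t
      rcases le_total t E with h | h
      · rw [max_eq_right (by linarith), zero_mul]
      · rw [max_eq_right (b := 0) (a := E - t) (by linarith), mul_zero]
    rw [this, cfc_const_zero]
    rfl
  have h2 : (B - algebraMap ℝ _ E) v = - cfc (fun t => max (E - t) 0) B v := by
    rw [hdec B hB, sub_apply, mem_spectralSubspace.1 hv, zero_sub]
  have h3 : (A - algebraMap ℝ _ E) v
      = cfc (fun t => max (t - E) 0) A v - cfc (fun t => max (E - t) 0) A v := by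
    rw [hdec A hA, sub_apply]
  have h4 : 0 ≤ RCLike.re (inner ℂ ((B - A) v) v) :=
    ((ContinuousLinearMap.le_def _ _).1 hAB).re_inner_nonneg_left v
  have h5 : (B - A) v = (B - algebraMap ℝ _ E) v - (A - algebraMap ℝ _ E) v := by
    simp
  have h6 : 0 ≤ RCLike.re (inner ℂ (cfc (fun t => max (E - t) 0) B v) v) :=
    ((ContinuousLinearMap.nonneg_iff_isPositive _).1 (hneg B)).re_inner_nonneg_left v
  -- The form of B - A at `v` is minus the form of (B - E)₋ minus that of (A - E)₊. Being
  -- nonnegative, it forces (A - E)₊ v = 0, so `v` lies in the spectral subspace of A to which it is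
  -- orthogonal.
  rw [h5, h2, h3, inner_sub_left, inner_sub_left, h1, inner_neg_left, sub_zero, map_sub,
    map_neg] at h4
  have h7 : v ∈ spectralSubspace A E :=
    apply_eq_zero_of_re_inner_le_zero hpos (by linarith)
  exact (Submodule.mem_bot ℂ).2 (inner_self_eq_zero.1 (hv' v h7))

/-- The value `f(T)` of the continuous functional calculus. -/
def functionOp (f : ℝ → ℝ) (T : H →L[ℂ] H) : H →L[ℂ] H := cfc f T

theorem mem_Icc_of_mem_spectrum {T : H →L[ℂ] H} {C : ℝ} (hC : ‖T‖ ≤ C) {t : ℝ}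
    (ht : t ∈ spectrum ℝ T) : t ∈ Set.Icc (-C) C := by
  have h1 := spectrum.norm_le_norm_mul_of_mem ht
  have h2 : ‖T‖ * ‖(1 : H →L[ℂ] H)‖ ≤ ‖T‖ * 1 :=
    mul_le_mul_of_nonneg_left ContinuousLinearMap.norm_id_le (norm_nonneg T)
  rw [Real.norm_eq_abs] at h1
  exact abs_le.1 (by linarith)

theorem norm_functionOp_le {T : H →L[ℂ] H} {C : ℝ} (hC : ‖T‖ ≤ C) {f : ℝ → ℝ} {B : ℝ}
    (hB0 : 0 ≤ B) (hB : ∀ t ∈ Set.Icc (-C) C, ‖f t‖ ≤ B) : ‖functionOp f T‖ ≤ B :=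
  norm_cfc_le hB0 fun t ht => hB t (mem_Icc_of_mem_spectrum hC ht)

theorem norm_polynomialOp_sub_functionOp_le {T : H →L[ℂ] H} (hT : IsSelfAdjoint T) {C : ℝ}
    (hC : ‖T‖ ≤ C) {f : ℝ → ℝ} (hf : Continuous f) {q : Polynomial ℝ} {ε : ℝ} (hε : 0 ≤ ε)
    (hq : ∀ t ∈ Set.Icc (-C) C, |q.eval t - f t| ≤ ε) :
    ‖polynomialOp q T - functionOp f T‖ ≤ ε := by
  rw [polynomialOp, functionOp, ← cfc_polynomial q T hT, ← cfc_sub _ _ T]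
  exact norm_cfc_le hε fun t ht => hq t (mem_Icc_of_mem_spectrum hC ht)

end HilbertSpace
-- Coordinates and matrix elements on ℓ²
section Ell2

variable {V : Type*}

theorem sum_sq_norm_le (φ : ell2 V) (s : Finset V) : ∑ x ∈ s, ‖φ x‖ ^ 2 ≤ ‖φ‖ ^ 2 := by
  simpa using lp.sum_rpow_le_norm_rpow (p := 2) (by norm_num) φ s

variable [DecidableEq V]

theorem delta_apply (x y : V) : (delta x : ell2 V) y = if y = x then 1 else 0 := by
  simp [delta, lp.single_apply, Pi.single_apply]

theorem norm_delta (x : V) : ‖(delta x : ell2 V)‖ = 1 := by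
  simp [delta, lp.norm_single]

theorem inner_delta_left (x : V) (φ : ell2 V) : inner ℂ (delta x) φ = φ x := by
  simp [delta, lp.inner_single_left]

theorem inner_delta_right (x : V) (φ : ell2 V) :
    inner ℂ φ (delta x) = (starRingEnd ℂ) (φ x) := by
  rw [← inner_conj_symm, inner_delta_left]

theorem norm_coe_le (φ : ell2 V) (x : V) : ‖φ x‖ ≤ ‖φ‖ := by
  rw [← inner_delta_left]
  simpa [norm_delta] using norm_inner_le_norm (𝕜 := ℂ) (delta x) φ

theorem hasSum_apply_delta (S : ell2 V →L[ℂ] ell2 V) (φ : ell2 V) :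
    HasSum (fun y => φ y • S (delta y)) (S φ) := by
  have := (lp.hasSum_single (E := fun _ : V => ℂ) (p := 2) (by norm_num) φ).mapL S
  convert this using 2 with y
  rw [← map_smul]
  congr 1
  ext z
  by_cases h : z = y
  · subst h; simp [delta]
  · simp [delta, lp.single_apply, h]

theorem hasSum_mul_delta (S : ell2 V →L[ℂ] ell2 V) (φ : ell2 V) (x : V) :
    HasSum (fun y => φ y * S (delta y) x) (S φ x) := by
  have h := (hasSum_apply_delta S φ).mapL (innerSL ℂ (delta x : ell2 V))
  simpa only [innerSL_apply_apply, inner_delta_left, inner_smul_right] using h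

end Ell2

/-! ### Translations of the lattice and of configurations -/

section Shift

variable {d : ℕ}

/-- Translation by `z` as an automorphism of the lattice. -/
def latticeShift (z : Fin d → ℤ) : lattice d ≃g lattice d where
  toEquiv := Equiv.addRight z
  map_rel_iff' := by
    intro x y
    simp [lattice]

/-- Translation of configurations. -/
def shift (z : Fin d → ℤ) (ω : Config d) : Config d :=
  fun e => ω ((latticeShift z).mapEdgeSet.symm e)

theorem percGraph_adj {ω : Config d} {x y : Fin d → ℤ} :
    (percGraph ω).Adj x y ↔ ∃ h : (lattice d).Adj x y, ω ⟨s(x, y), h⟩ = true := by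
  rw [percGraph, SimpleGraph.fromEdgeSet_adj]
  constructor
  · rintro ⟨⟨h, h'⟩, -⟩
    exact ⟨h, h'⟩
  · rintro ⟨h, h'⟩
    exact ⟨⟨h, h'⟩, h.ne⟩

theorem percGraph_shift_adj (z : Fin d → ℤ) (ω : Config d) (x y : Fin d → ℤ) :
    (percGraph (shift z ω)).Adj (x + z) (y + z) ↔ (percGraph ω).Adj x y := by
  rw [percGraph_adj, percGraph_adj]
  have h : (lattice d).Adj (x + z) (y + z) ↔ (lattice d).Adj x y :=
    (latticeShift z).map_rel_iff' (a := x) (b := y)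
  constructor
  · rintro ⟨h', e⟩
    refine ⟨h.1 h', ?_⟩
    rw [← e]
    exact congrArg ω ((Equiv.symm_apply_apply (latticeShift z).mapEdgeSet ⟨s(x, y), h.1 h'⟩).symm)
  · rintro ⟨h', e⟩
    refine ⟨h.2 h', ?_⟩
    rw [← e]
    exact congrArg ω (Equiv.symm_apply_apply (latticeShift z).mapEdgeSet ⟨s(x, y), h'⟩)

instance (p : unitInterval) : IsProbabilityMeasure (percLaw d p) := by
  unfold percLaw; infer_instance

/-- A translation only permutes the edges, and the edge variables are identically distributed. -/
theorem measurePreserving_shift (p : unitInterval) (z : Fin d → ℤ) :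
    MeasurePreserving (shift z) (percLaw d p) (percLaw d p) := by
  have h := Measure.infinitePi_map_piCongrLeft (X := fun _ : (lattice d).edgeSet => Bool)
    (fun _ : (lattice d).edgeSet => bernoulliMeasure true false p) (latticeShift z).mapEdgeSet
  have e : shift z = MeasurableEquiv.piCongrLeft (fun _ : (lattice d).edgeSet => Bool)
      (latticeShift z).mapEdgeSet := by
    funext ω a
    obtain ⟨b, rfl⟩ := (latticeShift z).mapEdgeSet.surjective a
    rw [MeasurableEquiv.coe_piCongrLeft, Equiv.piCongrLeft_apply_apply]
    unfold shift
    rw [Equiv.symm_apply_apply]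
  refine ⟨?_, ?_⟩
  · rw [e]; exact MeasurableEquiv.measurable _
  · rw [e]; exact h

end Shift

/-! ### The algebra of covariant operator families -/

section Covariant

variable {d : ℕ}

/-- Uniformly bounded measurable families of operators on `ℓ²(ℤ^d)` that are covariant under
translations. -/
structure IsCovariant (T : Config d → (ell2 (Fin d → ℤ) →L[ℂ] ell2 (Fin d → ℤ))) : Prop where
  meas : ∀ x y, Measurable fun ω => T ω (delta y) x
  cov : ∀ z x y ω, T (shift z ω) (delta (y + z)) (x + z) = T ω (delta y) x
  bdd : ∃ C, 0 ≤ C ∧ ∀ ω, ‖T ω‖ ≤ C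

namespace IsCovariant

variable {S T : Config d → (ell2 (Fin d → ℤ) →L[ℂ] ell2 (Fin d → ℤ))}

theorem one : IsCovariant (fun _ : Config d => (1 : ell2 (Fin d → ℤ) →L[ℂ] ell2 (Fin d → ℤ))) where
  meas x y := measurable_const
  cov z x y ω := by simp [delta_apply]
  bdd := ⟨1, zero_le_one, fun _ => ContinuousLinearMap.norm_id_le⟩

theorem smul (c : ℂ) (hT : IsCovariant T) : IsCovariant fun ω => c • T ω where
  meas x y := by simpa using (hT.meas x y).const_mul c
  cov z x y ω := by simp [hT.cov z x y ω]
  bdd := by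
    obtain ⟨C, h0, hC⟩ := hT.bdd
    refine ⟨‖c‖ * C, by positivity, fun ω => ?_⟩
    rw [norm_smul]
    exact mul_le_mul_of_nonneg_left (hC ω) (norm_nonneg c)

theorem add (hS : IsCovariant S) (hT : IsCovariant T) : IsCovariant fun ω => S ω + T ω where
  meas x y := (hS.meas x y).add (hT.meas x y)
  cov z x y ω := by simp [hT.cov z x y ω, hS.cov z x y ω]
  bdd := by
    obtain ⟨C, h0, hC⟩ := hT.bdd
    obtain ⟨C', h0', hC'⟩ := hS.bdd
    exact ⟨C' + C, by positivity, fun ω => (norm_add_le _ _).trans (add_le_add (hC' ω) (hC ω))⟩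

theorem sub (hS : IsCovariant S) (hT : IsCovariant T) : IsCovariant fun ω => S ω - T ω := by
  simpa [sub_eq_add_neg] using hS.add (hT.smul (-1))

theorem mul (hS : IsCovariant S) (hT : IsCovariant T) : IsCovariant fun ω => S ω * T ω where
  meas x y := by
    -- Matrix elements of a product are series over the intermediate site, limits of finite sums of
    -- measurable functions; covariance follows by translating that site.
    refine measurable_of_tendsto_metrizable' (atTop : Filter (Finset (Fin d → ℤ)))
      (f := fun s ω => ∑ z ∈ s, T ω (delta y) z * S ω (delta z) x) (fun s => ?_) ?_
    · exact Finset.measurable_sum _ fun z _ => (hT.meas z y).mul (hS.meas x z)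
    · rw [tendsto_pi_nhds]
      exact fun ω => hasSum_mul_delta (S ω) (T ω (delta y)) x
  cov z x y ω := by
    refine (hasSum_mul_delta (S (shift z ω)) (T (shift z ω) (delta (y + z))) (x + z)).unique ?_
    rw [← (Equiv.addRight z).hasSum_iff]
    simpa [Function.comp_def, hS.cov, hT.cov] using hasSum_mul_delta (S ω) (T ω (delta y)) x
  bdd := by
    obtain ⟨C, h0, hC⟩ := hT.bdd
    obtain ⟨C', h0', hC'⟩ := hS.bdd
    exact ⟨C' * C, by positivity, fun ω => (norm_mul_le _ _).trans
      (mul_le_mul (hC' ω) (hC ω) (norm_nonneg _) h0')⟩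

theorem pow (hT : IsCovariant T) (n : ℕ) : IsCovariant fun ω => T ω ^ n := by
  induction n with
  | zero => simpa using one
  | succ n ih => simpa [pow_succ] using ih.mul hT

/-- Strong limits of uniformly bounded covariant families are covariant. -/
theorem of_tendsto {F : ℕ → Config d → (ell2 (Fin d → ℤ) →L[ℂ] ell2 (Fin d → ℤ))}
    (hF : ∀ n, IsCovariant (F n)) {C : ℝ} (h0 : 0 ≤ C) (hC : ∀ ω, ‖T ω‖ ≤ C)
    (hlim : ∀ ω φ, Tendsto (fun n => F n ω φ) atTop (𝓝 (T ω φ))) : IsCovariant T := by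
  have hlim' : ∀ ω x y, Tendsto (fun n => F n ω (delta y) x) atTop (𝓝 (T ω (delta y) x)) := by
    intro ω x y
    have := ((innerSL ℂ (delta x : ell2 (Fin d → ℤ))).continuous.tendsto _).comp
      (hlim ω (delta y))
    simpa only [innerSL_apply_apply, inner_delta_left, Function.comp_def] using this
  refine ⟨fun x y => ?_, fun z x y ω => ?_, C, h0, hC⟩
  · exact measurable_of_tendsto_metrizable (fun n => (hF n).meas x y)
      (tendsto_pi_nhds.2 fun ω => hlim' ω x y)
  · refine tendsto_nhds_unique (hlim' (shift z ω) (x + z) (y + z)) ?_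
    simpa only [(hF _).cov] using hlim' ω x y

theorem polynomialOp (hT : IsCovariant T) (q : Polynomial ℝ) :
    IsCovariant fun ω => polynomialOp q (T ω) := by
  induction q using Polynomial.induction_on' with
  | add q r hq hr => simpa only [polynomialOp_add] using hq.add hr
  | monomial n a => simpa only [polynomialOp_monomial] using (hT.pow n).smul (a : ℂ)

/-- The continuous functional calculus preserves covariance. -/
theorem functionOp (hT : IsCovariant T) (hsa : ∀ ω, IsSelfAdjoint (T ω)) {f : ℝ → ℝ}
    (hf : Continuous f) : IsCovariant fun ω => functionOp f (T ω) := by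
  obtain ⟨C, h0, hC⟩ := hT.bdd
  -- The uniform norm bound puts every spectrum in [-C, C], so one Weierstrass sequence of
  -- polynomials serves all ω.
  choose q hq using fun n : ℕ => exists_polynomial_near_of_continuousOn (-C) C f hf.continuousOn
    (1 / ((n : ℝ) + 1)) (by positivity)
  obtain ⟨B, hB⟩ := (isCompact_Icc (a := -C) (b := C)).exists_bound_of_continuousOn hf.continuousOn
  have hB0 : 0 ≤ B := (norm_nonneg _).trans (hB 0 ⟨by linarith, h0⟩)
  refine of_tendsto (fun n => hT.polynomialOp (q n)) hB0
    (fun ω => norm_functionOp_le (hC ω) hB0 hB) fun ω φ => ?_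
  have hnorm : Tendsto (fun n => BondPercolation.polynomialOp (q n) (T ω)) atTop
      (𝓝 (BondPercolation.functionOp f (T ω))) := by
    rw [tendsto_iff_norm_sub_tendsto_zero]
    exact squeeze_zero (fun _ => norm_nonneg _) (fun n => norm_polynomialOp_sub_functionOp_le
      (hsa ω) (hC ω) hf (by positivity) fun t ht => (hq n t ht).le)
      tendsto_one_div_add_atTop_nhds_zero_nat
  exact ((ContinuousLinearMap.apply ℂ _ φ).continuous.tendsto _).comp hnorm

/-- The discontinuous function is reached as the strong limit of the continuous ramps. -/
theorem heavisideOp (hT : IsCovariant T) (hsa : ∀ ω, IsSelfAdjoint (T ω)) (E : ℝ) :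
    IsCovariant fun ω => heavisideOp (T ω) E := by
  refine of_tendsto (F := fun n ω => BondPercolation.functionOp (ramp E n) (T ω))
    (fun n => hT.functionOp hsa ?_)
    zero_le_one (fun ω => Submodule.starProjection_norm_le _)
    fun ω φ => tendsto_cfc_ramp (T ω) (hsa ω) E φ
  unfold ramp
  refine continuous_const.sub (Continuous.div (by fun_prop) (by fun_prop) fun t => ?_)
  exact (lt_max_of_lt_right (by positivity)).ne'

end IsCovariant
end Covariant
-- Powers and ergodic averages of 1 - PQP for two projections
section TwoProjections

variable {H : Type*} [NormedAddCommGroup H] [InnerProductSpace ℂ H] [CompleteSpace H]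
  (U V : Submodule ℂ H) [U.HasOrthogonalProjection] [V.HasOrthogonalProjection]

theorem star_starProjection_mul :
    star (V.starProjection * U.starProjection) = U.starProjection * V.starProjection := by
  rw [star_mul, isSelfAdjoint_starProjection U |>.star_eq,
    isSelfAdjoint_starProjection V |>.star_eq]

/-- The operator PQP is written as PQ · QP, of the form A*A; reversing the two factors gives QP · PQ
= QPQ, as the trace argument requires. -/
theorem starProjection_product_mem :
    0 ≤ U.starProjection * V.starProjection * (V.starProjection * U.starProjection) ∧
      U.starProjection * V.starProjection * (V.starProjection * U.starProjection) ≤ 1 := by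
  have h0 : 0 ≤ U.starProjection * V.starProjection * (V.starProjection * U.starProjection) := by
    rw [← star_starProjection_mul]
    exact star_mul_self_nonneg _
  refine ⟨h0, (CStarAlgebra.norm_le_one_iff_of_nonneg _ h0).1 ?_⟩
  have hU := Submodule.starProjection_norm_le U
  have hV := Submodule.starProjection_norm_le V
  have h1 := norm_mul_le U.starProjection V.starProjection
  have h2 := norm_mul_le V.starProjection U.starProjection
  refine (norm_mul_le _ _).trans (mul_le_one₀ (h1.trans ?_) (norm_nonneg _) (h2.trans ?_))
  · exact mul_le_one₀ hU (norm_nonneg _) hV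
  · exact mul_le_one₀ hV (norm_nonneg _) hU

theorem norm_one_sub_le :
    ‖1 - U.starProjection * V.starProjection * (V.starProjection * U.starProjection)‖ ≤ 1 := by
  obtain ⟨h0, h1⟩ := starProjection_product_mem U V
  exact (CStarAlgebra.norm_le_one_iff_of_nonneg _ (sub_nonneg.2 h1)).2 (sub_le_self _ h0)

/-- The iterates of `1 - PQP` converge in mean to `1 - P` when the range of `P` meets the kernel of
`Q` only in `0`. -/
theorem tendsto_birkhoffAverage_one_sub (hUV : U ⊓ Vᗮ = ⊥) (φ : H) :
    Tendsto (fun n => birkhoffAverage ℂ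
      ⇑(1 - U.starProjection * V.starProjection * (V.starProjection * U.starProjection))
      _root_.id n φ) atTop (𝓝 (φ - U.starProjection φ)) := by
  have hnorm := norm_one_sub_le U V
  set M := U.starProjection * V.starProjection * (V.starProjection * U.starProjection) with hM
  -- PQP v = 0 forces QP v = 0, so P v lies in the range of P and the kernel of Q and vanishes. The
  -- fixed space is thus the kernel of P, onto which the mean ergodic theorem projects.
  have hfix : ((1 - M).eqLocus (1 : H →L[ℂ] H)) = Uᗮ := by
    ext v
    have e1 : v ∈ (1 - M).eqLocus (1 : H →L[ℂ] H) ↔ M v = 0 := by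
      rw [LinearMap.mem_eqLocus]
      simp
    rw [e1, ← Submodule.starProjection_apply_eq_zero_iff]
    constructor
    · intro hv
      have h2 : (V.starProjection * U.starProjection) v = 0 := by
        have : inner ℂ (M v) v = (0 : ℂ) := by rw [hv, inner_zero_left]
        rw [hM, ← star_starProjection_mul, mul_apply_eq_comp, ContinuousLinearMap.star_eq_adjoint,
          ContinuousLinearMap.adjoint_inner_left] at this
        exact inner_self_eq_zero.1 this
      rw [mul_apply_eq_comp, Submodule.starProjection_apply_eq_zero_iff] at h2
      have h3 : U.starProjection v ∈ U ⊓ Vᗮ :=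
        ⟨Submodule.starProjection_apply_mem _ _, h2⟩
      rwa [hUV] at h3
    · intro hv
      simp [hM, mul_apply_eq_comp, hv]
  have h := ContinuousLinearMap.tendsto_birkhoffAverage_orthogonalProjection (1 - M) hnorm φ
  convert h using 2
  rw [← Submodule.starProjection_apply]
  simp only [hfix]
  rw [Submodule.starProjection_orthogonal_val]

/-- The positive operator (1 - PQP)^k is the identity on the kernel of P, so by symmetry it has no
cross terms between that kernel and the range of P. The part on the range is nonnegative and is
dropped. -/
theorem re_inner_sub_le_pow (k : ℕ) (φ : H) :
    (inner ℂ φ (φ - U.starProjection φ)).re ≤ (inner ℂ φ (((1 - U.starProjection *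
      V.starProjection * (V.starProjection * U.starProjection)) ^ k) φ)).re := by
  obtain ⟨h0, h1⟩ := starProjection_product_mem U V
  set N := U.starProjection * V.starProjection * (V.starProjection * U.starProjection) with hN
  set ψ := φ - U.starProjection φ with hψ
  have hsa : IsSelfAdjoint (1 - N) := (sub_nonneg.2 h1).isSelfAdjoint
  have hpos : 0 ≤ (1 - N) ^ k := CStarAlgebra.pow_nonneg (sub_nonneg.2 h1) k
  have hsym := ContinuousLinearMap.isSelfAdjoint_iff_isSymmetric.1 (hsa.pow k)
  have hUψ : U.starProjection ψ = 0 := by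
    rw [Submodule.starProjection_apply_eq_zero_iff]
    exact Submodule.sub_starProjection_mem_orthogonal φ
  have hNψ : ∀ j : ℕ, ((1 - N) ^ j) ψ = ψ := by
    intro j
    induction j with
    | zero => simp
    | succ j ih =>
      rw [pow_succ, mul_apply_eq_comp]
      have : (1 - N) ψ = ψ := by simp [hN, mul_apply_eq_comp, hUψ]
      rw [this, ih]
  have hdec : φ = U.starProjection φ + ψ := by rw [hψ]; abel
  have horth : inner ℂ ψ (U.starProjection φ) = (0 : ℂ) :=
    Submodule.starProjection_inner_eq_zero _ _ (Submodule.starProjection_apply_mem _ _)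
  have e1 : ((1 - N) ^ k) φ = ((1 - N) ^ k) (U.starProjection φ) + ψ := by
    conv_lhs => rw [hdec]
    rw [map_add, hNψ]
  have e2 : inner ℂ φ (((1 - N) ^ k) (U.starProjection φ))
      = inner ℂ (U.starProjection φ) (((1 - N) ^ k) (U.starProjection φ)) := by
    conv_lhs => rw [hdec]
    have h3 := hsym ψ (U.starProjection φ)
    simp only [ContinuousLinearMap.coe_coe, hNψ] at h3
    rw [map_add, map_add, hUψ, map_zero, add_zero,
      show U.starProjection (U.starProjection φ) = U.starProjection φ from
        Submodule.starProjection_eq_self_iff.2 (Submodule.starProjection_apply_mem _ _),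
      inner_add_left, ← h3, horth, add_zero]
  have h4 : 0 ≤ (inner ℂ (U.starProjection φ) (((1 - N) ^ k) (U.starProjection φ))).re :=
    ((ContinuousLinearMap.nonneg_iff_isPositive _).1 hpos).re_inner_nonneg_right _
  rw [e1, inner_add_right, e2, Complex.add_re]
  linarith

end TwoProjections

/-! ### Covariance and ordering of the percolation Laplacians -/

section Laplacian

variable {d : ℕ}

/-- A finite set containing the neighbours of a lattice point. -/
def neighbors (x : Fin d → ℤ) : Finset (Fin d → ℤ) :=
  (Finset.univ ×ˢ ({1, -1} : Finset ℤ)).image fun q : Fin d × ℤ => x + Pi.single q.1 q.2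

theorem mem_neighbors {x y : Fin d → ℤ} : y ∈ neighbors x ↔ (lattice d).Adj x y := by
  constructor
  · intro h
    simp only [neighbors, Finset.mem_image, Finset.mem_product, Finset.mem_univ, true_and,
      Finset.mem_insert, Finset.mem_singleton] at h
    obtain ⟨⟨i, s⟩, hs, rfl⟩ := h
    change ∑ j, (x j - (x + Pi.single i s : Fin d → ℤ) j) ^ 2 = 1
    rw [Finset.sum_eq_single i]
    · rcases hs with rfl | rfl <;> simp
    · intro j _ hj; simp [hj]
    · simp
  · exact fun h => lattice_neighborSet_subset x h

open Classical in
theorem percGraph_neighborFinset (ω : Config d) (x : Fin d → ℤ) :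
    (percGraph ω).neighborFinset x = (neighbors x).filter ((percGraph ω).Adj x) := by
  ext y
  simp only [SimpleGraph.mem_neighborFinset, Finset.mem_filter, mem_neighbors]
  exact ⟨fun h => ⟨percGraph_le ω h, h⟩, fun h => h.2⟩

theorem measurableSet_adj (x y : Fin d → ℤ) :
    MeasurableSet {ω : Config d | (percGraph ω).Adj x y} := by
  by_cases h : (lattice d).Adj x y
  · have : {ω : Config d | (percGraph ω).Adj x y}
        = (fun ω : Config d => ω ⟨s(x, y), h⟩) ⁻¹' {true} := by
      ext ω
      simp only [Set.mem_ofPred_eq, percGraph_adj, Set.mem_preimage, Set.mem_singleton_iff]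
      exact ⟨fun ⟨_, e⟩ => e, fun e => ⟨h, e⟩⟩
    rw [this]
    exact measurable_pi_apply _ (measurableSet_singleton _)
  · have : {ω : Config d | (percGraph ω).Adj x y} = ∅ := by
      ext ω
      simp [percGraph_adj, h]
    rw [this]
    exact MeasurableSet.empty

/-- Translation as an isomorphism of percolation graphs. -/
def percGraphShift (z : Fin d → ℤ) (ω : Config d) : percGraph ω ≃g percGraph (shift z ω) where
  toEquiv := Equiv.addRight z
  map_rel_iff' := percGraph_shift_adj z ω _ _

theorem isCovariant_adjacencyOp :
    IsCovariant fun ω : Config d => adjacencyOp (percGraph ω) (percGraph_degree_le ω) := by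
  classical
  have key : ∀ (ω : Config d) x y, adjacencyOp (percGraph ω) (percGraph_degree_le ω) (delta y) x
      = if (percGraph ω).Adj x y then (1 : ℂ) else 0 := by
    intro ω x y
    simp [delta_apply, SimpleGraph.mem_neighborFinset]
  refine ⟨fun x y => ?_, fun z x y ω => ?_, 2 * d, by positivity,
    fun ω => LinearMap.mkContinuous_norm_le _ (by positivity) _⟩
  · simp only [key]
    exact Measurable.ite (measurableSet_adj x y) measurable_const measurable_const
  · simp only [key, percGraph_shift_adj]

theorem isCovariant_degreeOp :
    IsCovariant fun ω : Config d => degreeOp (percGraph ω) (percGraph_degree_le ω) := by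
  classical
  refine ⟨fun x y => ?_, fun z x y ω => ?_, 2 * d, by positivity,
    fun ω => LinearMap.mkContinuous_norm_le _ (by positivity) _⟩
  · simp only [degreeOp_apply]
    refine Measurable.mul_const ?_ _
    have : ∀ ω : Config d, ((percGraph ω).degree x : ℂ)
        = ∑ y ∈ neighbors x, if (percGraph ω).Adj x y then (1 : ℂ) else 0 := by
      intro ω
      rw [← SimpleGraph.card_neighborFinset_eq_degree, percGraph_neighborFinset,
        Finset.sum_boole]
    simp only [this]
    exact Finset.measurable_sum _ fun y _ =>
      Measurable.ite (measurableSet_adj x y) measurable_const measurable_const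
  · have : (percGraph (shift z ω)).degree (x + z) = (percGraph ω).degree x :=
      (percGraphShift z ω).degree_eq x
    simp [delta_apply, this]

theorem isCovariant_percLaplacian (X : BoundaryCondition) :
    IsCovariant fun ω : Config d => percLaplacian X ω := by
  have hA := isCovariant_adjacencyOp (d := d)
  have hD := isCovariant_degreeOp (d := d)
  have h1 := (IsCovariant.one (d := d)).smul (2 * d : ℂ)
  cases X with
  | neumann => exact hD.sub hA
  | pseudoDirichlet => exact (h1.sub hD).add (hD.sub hA)
  | dirichlet => exact ((h1.sub hD).smul 2).add (hD.sub hA)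

theorem isSelfAdjoint_percLaplacian (X : BoundaryCondition) (ω : Config d) :
    IsSelfAdjoint (percLaplacian X ω) := isSelfAdjoint_laplacian _ _ X

/-- The difference is 2d - D, multiplication by a nonnegative function. -/
theorem percLaplacian_pseudoDirichlet_le (ω : Config d) :
    percLaplacian .pseudoDirichlet ω ≤ percLaplacian .dirichlet ω := by
  rw [ContinuousLinearMap.le_def, ContinuousLinearMap.isPositive_def']
  refine ⟨(isSelfAdjoint_percLaplacian _ ω).sub (isSelfAdjoint_percLaplacian _ ω), fun φ => ?_⟩
  rw [ContinuousLinearMap.reApplyInnerSelf_apply]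
  have e : (percLaplacian .dirichlet ω - percLaplacian .pseudoDirichlet ω) φ
      = ((2 * d : ℂ) • φ - degreeOp (percGraph ω) (percGraph_degree_le ω) φ) := by
    simp only [percLaplacian, laplacian, sub_apply, add_apply,
      smul_apply, ContinuousLinearMap.id_apply, two_smul]
    abel
  rw [e, lp.inner_eq_tsum, ← RCLike.reCLM_apply,
    RCLike.reCLM.map_tsum (lp.summable_inner _ _)]
  refine tsum_nonneg fun x => ?_
  have : (((2 * d : ℂ) • φ - degreeOp (percGraph ω) (percGraph_degree_le ω) φ) : ell2 _) x
      = (((2 * d - (percGraph ω).degree x : ℝ) : ℂ)) * φ x := by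
    change (2 * d : ℂ) * φ x - ((percGraph ω).degree x : ℂ) * φ x = _
    push_cast
    ring
  rw [this]
  have hd : ((percGraph ω).degree x : ℝ) ≤ 2 * d := by exact_mod_cast percGraph_degree_le ω x
  rw [← smul_eq_mul, inner_smul_left, Complex.conj_ofReal, RCLike.reCLM_apply]
  change 0 ≤ (_ : ℂ).re
  rw [Complex.re_ofReal_mul]
  refine mul_nonneg (by linarith) ?_
  rw [RCLike.inner_apply, Complex.mul_conj, Complex.ofReal_re]
  exact Complex.normSq_nonneg _

end Laplacian
-- The trace per unit volume and the comparison of the two Dirichlet-type operators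
section Trace

variable {d : ℕ} {S T : Config d → (ell2 (Fin d → ℤ) →L[ℂ] ell2 (Fin d → ℤ))}

theorem norm_apply_delta_le {V : Type*} [DecidableEq V] {R : ell2 V →L[ℂ] ell2 V} {C : ℝ}
    (hR : ‖R‖ ≤ C) (x y : V) : ‖R (delta y) x‖ ≤ C := by
  refine (norm_coe_le _ x).trans ((R.le_opNorm _).trans ?_)
  rwa [norm_delta, mul_one]

theorem IsCovariant.integrable (hT : IsCovariant T) (p : unitInterval) (x y : Fin d → ℤ) :
    Integrable (fun ω => T ω (delta y) x) (percLaw d p) := by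
  obtain ⟨C, h0, hC⟩ := hT.bdd
  exact Integrable.of_bound (hT.meas x y).aestronglyMeasurable C
    (ae_of_all _ fun ω => norm_apply_delta_le (hC ω) x y)

/-- The trace per unit volume of a product. -/
theorem hasSum_integral_mul (hS : IsCovariant S) (hT : IsCovariant T) (p : unitInterval) :
    HasSum (fun z => ∫ ω, T ω (delta 0) z * S ω (delta z) 0 ∂(percLaw d p))
      (∫ ω, (S ω * T ω) (delta 0) 0 ∂(percLaw d p)) := by
  obtain ⟨C, h0, hC⟩ := hT.bdd
  obtain ⟨B, hB0, hB⟩ := hS.bdd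
  have hint : ∀ z, Integrable (fun ω => T ω (delta 0) z * S ω (delta z) 0) (percLaw d p) := by
    intro z
    refine Integrable.of_bound ((hT.meas z 0).mul (hS.meas 0 z)).aestronglyMeasurable (C * B)
      (ae_of_all _ fun ω => ?_)
    rw [norm_mul]
    exact mul_le_mul (norm_apply_delta_le (hC ω) z 0) (norm_apply_delta_le (hB ω) 0 z)
      (norm_nonneg _) h0
  -- The row of S at 0 has the absolute values of S* δ₀, so both factors are square summable. The
  -- bound is uniform in ω and allows sum and integral to be exchanged.
  have h1 : ∀ ω, ∀ s : Finset (Fin d → ℤ),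
      ∑ z ∈ s, ‖T ω (delta 0) z * S ω (delta z) 0‖ ≤ C ^ 2 + B ^ 2 := by
    intro ω s
    have e : ∀ z, ‖S ω (delta z) 0‖ = ‖(ContinuousLinearMap.adjoint (S ω) (delta 0)) z‖ := by
      intro z
      rw [← inner_delta_left z, ContinuousLinearMap.adjoint_inner_right, ← inner_conj_symm,
        inner_delta_left, RCLike.norm_conj]
    have hT2 : ‖T ω (delta 0)‖ ≤ C := by
      refine ((T ω).le_opNorm _).trans ?_
      rw [norm_delta, mul_one]; exact hC ω
    have hS2 : ‖ContinuousLinearMap.adjoint (S ω) (delta 0)‖ ≤ B := by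
      refine (ContinuousLinearMap.le_opNorm _ _).trans ?_
      rw [norm_delta, mul_one, LinearIsometryEquiv.norm_map]; exact hB ω
    calc ∑ z ∈ s, ‖T ω (delta 0) z * S ω (delta z) 0‖
        ≤ ∑ z ∈ s, (‖T ω (delta 0) z‖ ^ 2
            + ‖(ContinuousLinearMap.adjoint (S ω) (delta 0)) z‖ ^ 2) := by
          refine Finset.sum_le_sum fun z _ => ?_
          rw [norm_mul, e]
          nlinarith [sq_nonneg (‖T ω (delta 0) z‖
            - ‖(ContinuousLinearMap.adjoint (S ω) (delta 0)) z‖),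
            sq_nonneg ‖T ω (delta 0) z‖,
            sq_nonneg ‖(ContinuousLinearMap.adjoint (S ω) (delta 0)) z‖]
      _ ≤ ‖T ω (delta 0)‖ ^ 2 + ‖ContinuousLinearMap.adjoint (S ω) (delta 0)‖ ^ 2 := by
          rw [Finset.sum_add_distrib]
          exact add_le_add (sum_sq_norm_le _ _) (sum_sq_norm_le _ _)
      _ ≤ C ^ 2 + B ^ 2 := by gcongr
  have hsum : Summable fun z =>
      ∫ ω, ‖T ω (delta 0) z * S ω (delta z) 0‖ ∂(percLaw d p) := by
    refine summable_of_sum_le (c := C ^ 2 + B ^ 2)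
      (fun z => integral_nonneg fun ω => norm_nonneg _) fun s => ?_
    rw [← integral_finsetSum _ fun z _ => (hint z).norm]
    calc ∫ ω, ∑ z ∈ s, ‖T ω (delta 0) z * S ω (delta z) 0‖ ∂(percLaw d p)
        ≤ ∫ _, (C ^ 2 + B ^ 2) ∂(percLaw d p) :=
          integral_mono (integrable_finsetSum _ fun z _ => (hint z).norm) (integrable_const _)
            fun ω => h1 ω s
      _ = C ^ 2 + B ^ 2 := by simp
  have h := hasSum_integral_of_summable_integral_norm hint hsum
  have e : ∀ ω, ∑' z, T ω (delta 0) z * S ω (delta z) 0 = (S ω * T ω) (delta 0) 0 :=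
    fun ω => (hasSum_mul_delta (S ω) (T ω (delta 0)) 0).tsum_eq
  simpa only [e] using h

/-- The trace per unit volume is tracial. -/
theorem integral_mul_comm (hS : IsCovariant S) (hT : IsCovariant T) (p : unitInterval) :
    ∫ ω, (S ω * T ω) (delta 0) 0 ∂(percLaw d p) = ∫ ω, (T ω * S ω) (delta 0) 0 ∂(percLaw d p) := by
  refine (hasSum_integral_mul hS hT p).unique ?_
  rw [← (Equiv.neg (Fin d → ℤ)).hasSum_iff]
  convert hasSum_integral_mul hT hS p using 2 with z
  have hmeas : Measurable fun ω => T ω (delta 0) (-z) * S ω (delta (-z)) 0 :=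
    (hT.meas _ _).mul (hS.meas _ _)
  -- Translating by -z sends the site pair (0, z) to (-z, 0), which turns the term at -z of one
  -- series into the term at z of the other.
  have h := (measurePreserving_shift (d := d) p (-z))
  simp only [Function.comp_apply, Equiv.neg_apply]
  rw [← h.map_eq, integral_map h.measurable.aemeasurable hmeas.aestronglyMeasurable, h.map_eq]
  refine integral_congr_ae (ae_of_all _ fun ω => ?_)
  have e1 := hT.cov (-z) 0 z ω
  have e2 := hS.cov (-z) z 0 ω
  rw [add_neg_cancel, zero_add] at e1 e2
  simp only [e1, e2]
  ring

/-- `(1 - ST)^k` and `(1 - TS)^k` have the same trace. -/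
theorem integral_one_sub_pow (hS : IsCovariant S) (hT : IsCovariant T) (p : unitInterval)
    (k : ℕ) : ∫ ω, ((1 - S ω * T ω) ^ k) (delta 0) 0 ∂(percLaw d p)
      = ∫ ω, ((1 - T ω * S ω) ^ k) (delta 0) 0 ∂(percLaw d p) := by
  -- With a common G, the powers become 1 - S(GT) and 1 - (GT)S, and a single use of traciality
  -- suffices. The recursion is G ↦ G + 1 - GTS.
  obtain ⟨G, hG, h1, h2⟩ : ∃ G, IsCovariant G ∧
      (∀ ω, (1 - S ω * T ω) ^ k = 1 - S ω * (G ω * T ω)) ∧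
      ∀ ω, (1 - T ω * S ω) ^ k = 1 - G ω * T ω * S ω := by
    induction k with
    | zero =>
      refine ⟨fun _ => 0, by simpa using IsCovariant.one.smul 0, fun ω => ?_, fun ω => ?_⟩ <;> simp
    | succ k ih =>
      obtain ⟨G, hG, h1, h2⟩ := ih
      refine ⟨fun ω => G ω + 1 - G ω * T ω * S ω,
        (hG.add IsCovariant.one).sub ((hG.mul hT).mul hS), fun ω => ?_, fun ω => ?_⟩
      · rw [pow_succ, h1]; noncomm_ring
      · rw [pow_succ, h2]; noncomm_ring
  have key : ∀ R : Config d → (ell2 (Fin d → ℤ) →L[ℂ] ell2 (Fin d → ℤ)), IsCovariant R →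
      ∫ ω, (1 - R ω) (delta 0) 0 ∂(percLaw d p)
        = 1 - ∫ ω, (R ω) (delta 0) 0 ∂(percLaw d p) := by
    intro R hR
    have : ∀ ω, (1 - R ω) (delta 0) 0 = 1 - (R ω) (delta 0) 0 := fun ω => by
      change (delta 0 : ell2 (Fin d → ℤ)) 0 - (R ω) (delta 0) 0 = _
      rw [delta_apply, if_pos rfl]
    simp only [this]
    rw [integral_sub (integrable_const _) (hR.integrable p 0 0)]
    simp
  simp only [h1, h2]
  rw [key _ (hS.mul (hG.mul hT)), key _ ((hG.mul hT).mul hS),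
    integral_mul_comm hS (hG.mul hT) p]

/-- If the range of `P_ω` meets the kernel of `Q_ω` only in `0`, then the trace per unit volume of
`P` is at most that of `Q`. -/
theorem integral_starProjection_le {U V : Config d → Submodule ℂ (ell2 (Fin d → ℤ))}
    [∀ ω, (U ω).HasOrthogonalProjection] [∀ ω, (V ω).HasOrthogonalProjection]
    (hU : IsCovariant fun ω => (U ω).starProjection)
    (hV : IsCovariant fun ω => (V ω).starProjection)
    (hUV : ∀ ω, U ω ⊓ (V ω)ᗮ = ⊥) (p : unitInterval) :
    ∫ ω, (inner ℂ (delta 0) ((U ω).starProjection (delta 0))).re ∂(percLaw d p)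
      ≤ ∫ ω, (inner ℂ (delta 0) ((V ω).starProjection (delta 0))).re ∂(percLaw d p) := by
  simp only [inner_delta_left]
  have hre : ∀ R : Config d → (ell2 (Fin d → ℤ) →L[ℂ] ell2 (Fin d → ℤ)), IsCovariant R →
      ∫ ω, (R ω (delta 0) 0).re ∂(percLaw d p) = (∫ ω, R ω (delta 0) 0 ∂(percLaw d p)).re :=
    fun R hR => integral_re (hR.integrable p 0 0)
  have hre' : ∀ R : Config d → (ell2 (Fin d → ℤ) →L[ℂ] ell2 (Fin d → ℤ)), IsCovariant R →
      Integrable (fun ω => (R ω (delta 0) 0).re) (percLaw d p) :=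
    fun R hR => (hR.integrable p 0 0).re
  set M : Config d → (ell2 (Fin d → ℤ) →L[ℂ] ell2 (Fin d → ℤ)) := fun ω => 1 -
    (U ω).starProjection * (V ω).starProjection * ((V ω).starProjection * (U ω).starProjection)
    with hM
  have hMc : IsCovariant M := IsCovariant.one.sub ((hU.mul hV).mul (hV.mul hU))
  have hsub : ∀ R : Config d → (ell2 (Fin d → ℤ) →L[ℂ] ell2 (Fin d → ℤ)), IsCovariant R →
      ∫ ω, ((delta 0 - R ω (delta 0) : ell2 (Fin d → ℤ)) 0).re ∂(percLaw d p)
        = 1 - ∫ ω, (R ω (delta 0) 0).re ∂(percLaw d p) := by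
    intro R hR
    have : ∀ ω, ((delta 0 - R ω (delta 0) : ell2 (Fin d → ℤ)) 0).re
        = 1 - (R ω (delta 0) 0).re := fun ω => by
      change ((delta 0 : ell2 (Fin d → ℤ)) 0 - _).re = _
      rw [delta_apply, if_pos rfl, Complex.sub_re, Complex.one_re]
    simp only [this]
    rw [integral_sub (integrable_const _) (hre' R hR)]
    simp
  -- the traces of the powers
  have hpow : ∀ k : ℕ, 1 - ∫ ω, ((V ω).starProjection (delta 0) 0).re ∂(percLaw d p)
      ≤ ∫ ω, ((M ω ^ k) (delta 0) 0).re ∂(percLaw d p) := by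
    intro k
    -- Traciality replaces PQP by QPQ; `re_inner_sub_le_pow` then applies for each ω with the two
    -- projections exchanged.
    rw [hre _ (hMc.pow k), hM, integral_one_sub_pow (hU.mul hV) (hV.mul hU) p k, ← hsub _ hV,
      ← hre _ ((IsCovariant.one.sub ((hV.mul hU).mul (hU.mul hV))).pow k)]
    refine integral_mono (hre' _ (IsCovariant.one.sub hV))
      (hre' _ ((IsCovariant.one.sub ((hV.mul hU).mul (hU.mul hV))).pow k)) fun ω => ?_
    have := re_inner_sub_le_pow (V ω) (U ω) k (delta 0)
    simpa only [inner_delta_left] using this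
  -- the traces of the averages
  have hnorm : ∀ ω, ‖M ω‖ ≤ 1 := fun ω => norm_one_sub_le (U ω) (V ω)
  have hnormpow : ∀ (k : ℕ) ω, ‖M ω ^ k‖ ≤ 1 := by
    intro k ω
    induction k with
    | zero => exact ContinuousLinearMap.norm_id_le
    | succ k ih =>
      rw [pow_succ]
      exact (norm_mul_le _ _).trans (mul_le_one₀ ih (norm_nonneg _) (hnorm ω))
  have hbirk : ∀ (n : ℕ) ω, (birkhoffAverage ℂ (M ω) _root_.id n (delta 0)) 0
      = (n : ℂ)⁻¹ * ∑ k ∈ Finset.range n, (M ω ^ k) (delta 0) 0 := by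
    intro n ω
    have hiter : ∀ (k : ℕ) (φ : ell2 (Fin d → ℤ)), (M ω)^[k] φ = (M ω ^ k) φ := by
      intro k φ
      induction k with
      | zero => simp
      | succ k ih => rw [Function.iterate_succ_apply', pow_succ', mul_apply_eq_comp, ih]
    simp only [birkhoffAverage, birkhoffSum, _root_.id, hiter]
    rw [← inner_delta_left 0, inner_smul_right, inner_sum]
    simp only [inner_delta_left]
  have havg : ∀ n : ℕ, 1 ≤ n → 1 - ∫ ω, ((V ω).starProjection (delta 0) 0).re ∂(percLaw d p)
      ≤ ∫ ω, ((birkhoffAverage ℂ (M ω) _root_.id n (delta 0)) 0).re ∂(percLaw d p) := by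
    intro n hn
    have hn' : (0 : ℝ) < n := by exact_mod_cast hn
    have e : ∀ ω, ((birkhoffAverage ℂ (M ω) _root_.id n (delta 0)) 0).re
        = (n : ℝ)⁻¹ * ∑ k ∈ Finset.range n, ((M ω ^ k) (delta 0) 0).re := by
      intro ω
      rw [hbirk, ← Complex.re_sum, ← Complex.re_ofReal_mul]
      push_cast; rfl
    simp only [e]
    rw [integral_const_mul, integral_finsetSum _ fun k _ => hre' _ (hMc.pow k),
      le_inv_mul_iff₀ hn']
    calc _ = ∑ _k ∈ Finset.range n,
          (1 - ∫ ω, ((V ω).starProjection (delta 0) 0).re ∂(percLaw d p)) := by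
          rw [Finset.sum_const, Finset.card_range, nsmul_eq_mul]
      _ ≤ _ := Finset.sum_le_sum fun k _ => hpow k
  -- For each ω this is the mean ergodic limit; all averages are contractions, so the constant 1
  -- dominates.
  have hlim : Tendsto (fun n : ℕ =>
      ∫ ω, ((birkhoffAverage ℂ (M ω) _root_.id n (delta 0)) 0).re ∂(percLaw d p)) atTop
      (𝓝 (∫ ω, ((delta 0 - (U ω).starProjection (delta 0) : ell2 (Fin d → ℤ)) 0).re
        ∂(percLaw d p))) := by
    refine tendsto_integral_of_dominated_convergence (fun _ => 1) (fun n => ?_)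
      (integrable_const _) (fun n => ae_of_all _ fun ω => ?_) (ae_of_all _ fun ω => ?_)
    · simp only [hbirk]
      exact (Complex.measurable_re.comp ((Finset.measurable_sum _ fun k _ =>
        (hMc.pow k).meas 0 0).const_mul _)).aestronglyMeasurable
    · rw [hbirk]
      refine (Complex.abs_re_le_norm _).trans ?_
      rw [norm_mul, norm_inv, Complex.norm_natCast]
      have h1 : ‖∑ k ∈ Finset.range n, (M ω ^ k) (delta 0) 0‖ ≤ n := by
        refine (norm_sum_le_of_le (n := fun _ => (1 : ℝ)) _ fun k _ => ?_).trans (by simp)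
        exact norm_apply_delta_le (hnormpow k ω) 0 0
      rcases Nat.eq_zero_or_pos n with rfl | hn
      · simp
      · rw [inv_mul_le_iff₀ (by exact_mod_cast hn), mul_one]
        exact h1
    · have h := tendsto_birkhoffAverage_one_sub (U ω) (V ω) (hUV ω) (delta 0)
      have h' := ((innerSL ℂ (delta 0 : ell2 (Fin d → ℤ))).continuous.tendsto _).comp h
      simp only [innerSL_apply_apply, inner_delta_left, Function.comp_def] at h'
      exact (Complex.continuous_re.tendsto _).comp h'
  rw [hsub _ hU] at hlim
  have := ge_of_tendsto hlim (eventually_atTop.2 ⟨1, havg⟩)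
  linarith

/-- For a single ω the diagonal elements need not be ordered by the operator inequality; only their
averages are compared, through the trace. -/
theorem ids_dirichlet_le (p : unitInterval) (E : ℝ) :
    ids d p .dirichlet E ≤ ids d p .pseudoDirichlet E := by
  unfold ids
  simp only [heavisideOp_eq]
  exact integral_starProjection_le
    ((isCovariant_percLaplacian _).heavisideOp (isSelfAdjoint_percLaplacian _) E)
    ((isCovariant_percLaplacian _).heavisideOp (isSelfAdjoint_percLaplacian _) E)
    (fun ω => spectralSubspace_inf_orthogonal (isSelfAdjoint_percLaplacian _ ω)
      (isSelfAdjoint_percLaplacian _ ω) (percLaplacian_pseudoDirichlet_le ω) E) p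

end Trace
-- Eigenvectors supported on isolated clusters
section Eigenvectors

variable {d : ℕ}

theorem sum_neighbors {M : Type*} [AddCommMonoid M] (x : Fin d → ℤ) (f : (Fin d → ℤ) → M) :
    ∑ y ∈ neighbors x, f y = ∑ i, (f (x + Pi.single i 1) + f (x + Pi.single i (-1))) := by
  rw [neighbors, Finset.sum_image, Finset.sum_product]
  · refine Finset.sum_congr rfl fun i _ => ?_
    rw [Finset.sum_pair (by decide)]
  · rintro ⟨i, s⟩ hi ⟨j, t⟩ hj h
    simp only [Finset.coe_product, Set.mem_prod, Finset.mem_coe, Finset.mem_insert,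
      Finset.mem_singleton] at hi hj
    have h' : (Pi.single i s : Fin d → ℤ) = Pi.single j t := add_left_cancel h
    have hs : s ≠ 0 := by rcases hi.2 with h | h <;> simp [h]
    have hij : i = j := by
      by_contra hne
      have := congrFun h' i
      rw [Pi.single_eq_same, Pi.single_eq_of_ne hne] at this
      exact hs this
    subst hij
    rw [Pi.single_injective i h']

theorem card_neighbors (x : Fin d → ℤ) : (neighbors x).card = 2 * d := by
  rw [Finset.card_eq_sum_ones, sum_neighbors]
  simp [mul_comm]

open Classical in
theorem neumann_apply (ω : Config d) (φ : ell2 (Fin d → ℤ)) (x : Fin d → ℤ) :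
    percLaplacian .neumann ω φ x
      = ∑ y ∈ neighbors x, if (percGraph ω).Adj x y then φ x - φ y else 0 := by
  change ((percGraph ω).degree x : ℂ) * φ x - ∑ y ∈ (percGraph ω).neighborFinset x, φ y = _
  rw [← SimpleGraph.card_neighborFinset_eq_degree, percGraph_neighborFinset,
    ← Finset.sum_filter, Finset.sum_sub_distrib, Finset.sum_const, nsmul_eq_mul]

-- A closed edge contributes 2φ(x) = φ(x) - (-φ(x)), as if the missing neighbour carried the value
-- -φ(x). Hence the odd extension in `dirichlet_restrictTo`.
open Classical in
theorem dirichlet_apply (ω : Config d) (φ : ell2 (Fin d → ℤ)) (x : Fin d → ℤ) :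
    percLaplacian .dirichlet ω φ x
      = ∑ y ∈ neighbors x, if (percGraph ω).Adj x y then φ x - φ y else 2 * φ x := by
  have h := neumann_apply ω φ x
  change (2 : ℂ) * ((2 * d : ℂ) * φ x - ((percGraph ω).degree x : ℂ) * φ x)
    + percLaplacian .neumann ω φ x = _
  rw [h, ← SimpleGraph.card_neighborFinset_eq_degree, percGraph_neighborFinset]
  have h2 : (2 * d : ℂ) = ∑ y ∈ neighbors x, (1 : ℂ) := by
    rw [Finset.sum_const, card_neighbors]; simp
  rw [h2, ← Finset.sum_boole, ← sub_mul, ← Finset.sum_sub_distrib, ← mul_assoc, mul_right_comm,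
    Finset.mul_sum, ← Finset.sum_add_distrib]
  refine Finset.sum_congr rfl fun y _ => ?_
  split_ifs <;> ring

/-- The restriction of a function to a finite set, as an element of `ℓ²`. -/
def restrictTo (S : Finset (Fin d → ℤ)) (F : (Fin d → ℤ) → ℝ) : ell2 (Fin d → ℤ) :=
  ∑ x ∈ S, (F x : ℂ) • delta x

theorem restrictTo_apply (S : Finset (Fin d → ℤ)) (F : (Fin d → ℤ) → ℝ) (y : Fin d → ℤ) :
    restrictTo S F y = if y ∈ S then (F y : ℂ) else 0 := by
  rw [← inner_delta_left, restrictTo, inner_sum]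
  simp only [inner_smul_right, inner_delta_left, delta_apply, mul_ite, mul_one, mul_zero,
    Finset.sum_ite_eq]

theorem norm_sq_restrictTo (S : Finset (Fin d → ℤ)) (F : (Fin d → ℤ) → ℝ) :
    ‖restrictTo S F‖ ^ 2 = ∑ x ∈ S, F x ^ 2 := by
  have h : (inner ℂ (restrictTo S F) (restrictTo S F) : ℂ) = ((∑ x ∈ S, F x ^ 2 : ℝ) : ℂ) := by
    conv_lhs => enter [2]; rw [restrictTo]
    rw [sum_inner]
    push_cast
    refine Finset.sum_congr rfl fun x hx => ?_
    rw [inner_smul_left, inner_delta_left, restrictTo_apply, if_pos hx, Complex.conj_ofReal, sq]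
  rw [← inner_self_eq_norm_sq (𝕜 := ℂ), h]
  exact Complex.ofReal_re _

/-- The inner product with δ₀ reads off F(0), and |F| ≤ 1 bounds the squared norm by |S|. -/
theorem div_card_le_of_le {S : Finset (Fin d → ℤ)} {F : (Fin d → ℤ) → ℝ} {a : ℝ} (h0 : 0 ∈ S)
    (hF : ∀ x, |F x| ≤ 1)
    (h : ‖(inner ℂ (restrictTo S F) (delta 0) : ℂ)‖ ^ 2 ≤ ‖restrictTo S F‖ ^ 2 * a) (ha : 0 ≤ a) :
    F 0 ^ 2 / S.card ≤ a := by
  have hS : (0 : ℝ) < S.card := by exact_mod_cast Finset.card_pos.2 ⟨0, h0⟩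
  rw [inner_delta_right, RCLike.norm_conj, restrictTo_apply, if_pos h0, Complex.norm_real,
    Real.norm_eq_abs, sq_abs, norm_sq_restrictTo] at h
  rw [div_le_iff₀' hS]
  refine h.trans (mul_le_mul_of_nonneg_right ?_ ha)
  calc ∑ x ∈ S, F x ^ 2 ≤ ∑ _x ∈ S, (1 : ℝ) :=
        Finset.sum_le_sum fun x _ => (sq_le_one_iff_abs_le_one _).2 (hF x)
    _ = S.card := by simp

/-- The configurations in which all edges inside `S` are open and all edges leaving `S` are
closed. -/
def isolated (S : Finset (Fin d → ℤ)) : Set (Config d) :=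
  {ω | ∀ x ∈ S, ∀ y ∈ neighbors x, (percGraph ω).Adj x y ↔ y ∈ S}

/-- A closed edge contributes nothing, and neither does the lattice difference across it when F
takes equal values at both ends. The lattice eigenvalue equation thus holds on the cluster; sites
outside S have no open edge into S. -/
theorem neumann_restrictTo {S : Finset (Fin d → ℤ)} {F : (Fin d → ℤ) → ℝ} {l : ℝ} {ω : Config d}
    (hω : ω ∈ isolated S) (hb : ∀ x ∈ S, ∀ y ∈ neighbors x, y ∉ S → F y = F x)
    (hF : ∀ x ∈ S, ∑ y ∈ neighbors x, (F x - F y) = l * F x) :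
    percLaplacian .neumann ω (restrictTo S F) = (l : ℂ) • restrictTo S F := by
  classical
  ext x
  rw [neumann_apply]
  change _ = (l : ℂ) * restrictTo S F x
  by_cases hx : x ∈ S
  · rw [restrictTo_apply, if_pos hx, ← Complex.ofReal_mul, ← hF x hx]
    push_cast
    refine Finset.sum_congr rfl fun y hy => ?_
    rw [hω x hx y hy, restrictTo_apply]
    by_cases hyS : y ∈ S
    · simp [hyS]
    · simp [hyS, hb x hx y hy hyS]
  · rw [restrictTo_apply, if_neg hx, mul_zero]
    refine Finset.sum_eq_zero fun y hy => ?_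
    rw [ite_eq_right_iff]
    intro hadj
    have hyS : y ∉ S := fun hyS => hx
      ((hω y hyS x (mem_neighbors.2 (mem_neighbors.1 hy).symm)).1 hadj.symm)
    rw [restrictTo_apply, if_neg hyS, sub_zero]

theorem dirichlet_restrictTo {S : Finset (Fin d → ℤ)} {F : (Fin d → ℤ) → ℝ} {l : ℝ} {ω : Config d}
    (hω : ω ∈ isolated S) (hb : ∀ x ∈ S, ∀ y ∈ neighbors x, y ∉ S → F y = -F x)
    (hF : ∀ x ∈ S, ∑ y ∈ neighbors x, (F x - F y) = l * F x) :
    percLaplacian .dirichlet ω (restrictTo S F) = (l : ℂ) • restrictTo S F := by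
  classical
  ext x
  rw [dirichlet_apply]
  change _ = (l : ℂ) * restrictTo S F x
  by_cases hx : x ∈ S
  · rw [restrictTo_apply, if_pos hx, ← Complex.ofReal_mul, ← hF x hx]
    push_cast
    refine Finset.sum_congr rfl fun y hy => ?_
    rw [hω x hx y hy, restrictTo_apply]
    by_cases hyS : y ∈ S
    · simp [hyS]
    · simp only [hyS, if_false, hb x hx y hy hyS]
      push_cast; ring
  · rw [restrictTo_apply, if_neg hx, mul_zero, mul_zero]
    refine Finset.sum_eq_zero fun y hy => ?_
    rw [ite_eq_right_iff]
    intro hadj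
    have hyS : y ∉ S := fun hyS => hx
      ((hω y hyS x (mem_neighbors.2 (mem_neighbors.1 hy).symm)).1 hadj.symm)
    rw [restrictTo_apply, if_neg hyS, sub_zero]

end Eigenvectors

/-! ### Probability of isolation and the resulting bounds on the density of states -/

section Isolated

variable {d : ℕ}

theorem le_bernoulli_real_singleton (p : unitInterval) (b : Bool) :
    min (p : ℝ) (1 - p) ≤ (bernoulliMeasure true false p).real {b} := by
  cases b with
  | true =>
    rw [bernoulliMeasure_real_apply_of_mem_of_notMem p (measurableSet_singleton _) (by simp)
      (by simp)]
    exact min_le_left _ _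
  | false =>
    rw [bernoulliMeasure_real_apply_of_notMem_of_mem p (measurableSet_singleton _) (by simp)
      (by simp)]
    exact min_le_right _ _

/-- The event that `S` is isolated contains a measurable event of probability at least
`min(p, 1 - p) ^ (2 d |S|)`. -/
theorem exists_subset_isolated (p : unitInterval) (S : Finset (Fin d → ℤ)) :
    ∃ C ⊆ isolated S, MeasurableSet C ∧
      min (p : ℝ) (1 - p) ^ (2 * d * S.card) ≤ (percLaw d p).real C := by
  classical
  have hp0 := p.2.1
  have hp1 := p.2.2
  let Ed : Finset (lattice d).edgeSet := (S.sigma fun x => neighbors x).attach.image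
    fun q => ⟨s(q.1.1, q.1.2), mem_neighbors.1 (Finset.mem_sigma.1 q.2).2⟩
  -- Each edge meeting S is prescribed: open exactly when both endpoints lie in S. The cylinder
  -- event is measurable and has product probability.
  let t : (lattice d).edgeSet → Set Bool := fun e => {decide (∀ v ∈ e.1, v ∈ S)}
  have hcard : Ed.card ≤ 2 * d * S.card := by
    refine Finset.card_image_le.trans ?_
    rw [Finset.card_attach, Finset.card_sigma]
    simp [card_neighbors, mul_comm]
  refine ⟨Set.pi Ed t, fun ω hω x hx y hy => ?_,
    MeasurableSet.pi (Finset.countable_toSet _) fun _ _ => measurableSet_singleton _, ?_⟩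
  · have hmem : (⟨s(x, y), mem_neighbors.1 hy⟩ : (lattice d).edgeSet) ∈ Ed :=
      Finset.mem_image.2 ⟨⟨⟨x, y⟩, Finset.mem_sigma.2 ⟨hx, hy⟩⟩, Finset.mem_attach _ _, rfl⟩
    have h1 : ω ⟨s(x, y), mem_neighbors.1 hy⟩ = decide (∀ v ∈ s(x, y), v ∈ S) :=
      hω _ (Finset.mem_coe.2 hmem)
    have h2 : (∀ v ∈ s(x, y), v ∈ S) ↔ y ∈ S := by simp [Sym2.mem_iff, hx]
    rw [percGraph_adj, ← h2]
    constructor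
    · rintro ⟨_, h⟩
      exact of_decide_eq_true (h1.symm.trans h)
    · intro h
      exact ⟨mem_neighbors.1 hy, h1.trans (decide_eq_true h)⟩
  · have hq0 : 0 ≤ min (p : ℝ) (1 - p) := le_min hp0 (by linarith)
    have hq1 : min (p : ℝ) (1 - p) ≤ 1 := (min_le_left _ _).trans hp1
    rw [percLaw, measureReal_def, Measure.infinitePi_pi _ fun _ _ => measurableSet_singleton _,
      ENNReal.toReal_prod]
    calc min (p : ℝ) (1 - p) ^ (2 * d * S.card) ≤ min (p : ℝ) (1 - p) ^ Ed.card :=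
          pow_le_pow_of_le_one hq0 hq1 hcard
      _ = ∏ _e ∈ Ed, min (p : ℝ) (1 - p) := by rw [Finset.prod_const]
      _ ≤ _ := Finset.prod_le_prod (fun _ _ => hq0) fun e _ => le_bernoulli_real_singleton p _

theorem const_mul_le_integral {p : unitInterval} {f : Config d → ℝ}
    (hf : Integrable f (percLaw d p)) (hf0 : ∀ ω, 0 ≤ f ω) {S : Finset (Fin d → ℤ)} {c : ℝ}
    (hc0 : 0 ≤ c) (hc : ∀ ω ∈ isolated S, c ≤ f ω) :
    c * min (p : ℝ) (1 - p) ^ (2 * d * S.card) ≤ ∫ ω, f ω ∂(percLaw d p) := by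
  obtain ⟨C, hC, hCm, hCp⟩ := exists_subset_isolated p S
  calc c * min (p : ℝ) (1 - p) ^ (2 * d * S.card) ≤ c * (percLaw d p).real C :=
        mul_le_mul_of_nonneg_left hCp hc0
    _ = ∫ ω, C.indicator (fun _ => c) ω ∂(percLaw d p) := by
        rw [integral_indicator_const _ hCm, smul_eq_mul, mul_comm]
    _ ≤ _ := by
        refine integral_mono ((integrable_const c).indicator hCm) hf fun ω => ?_
        by_cases h : ω ∈ C
        · simpa [h] using hc ω (hC h)
        · simpa [h] using hf0 ω

theorem integrable_heaviside (p : unitInterval) (X : BoundaryCondition) (E : ℝ) :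
    Integrable (fun ω : Config d =>
      (inner ℂ (delta 0) (heavisideOp (percLaplacian X ω) E (delta 0))).re) (percLaw d p) := by
  simp only [inner_delta_left]
  exact (((isCovariant_percLaplacian X).heavisideOp
    (isSelfAdjoint_percLaplacian X) E).integrable p 0 0).re

/-- An eigenfunction of the Neumann Laplacian on `S` bounds the integrated density of states from
below. -/
theorem le_ids_neumann_sub {S : Finset (Fin d → ℤ)} {F : (Fin d → ℤ) → ℝ} {l : ℝ}
    (p : unitInterval) (h0 : 0 ∈ S) (hb : ∀ x ∈ S, ∀ y ∈ neighbors x, y ∉ S → F y = F x)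
    (hF : ∀ x ∈ S, ∑ y ∈ neighbors x, (F x - F y) = l * F x) (hF1 : ∀ x, |F x| ≤ 1)
    {E : ℝ} (hl0 : 0 < l) (hl : l ≤ E) :
    F 0 ^ 2 / S.card * min (p : ℝ) (1 - p) ^ (2 * d * S.card)
      ≤ ids d p .neumann E - ids d p .neumann 0 := by
  rw [ids, ids, ← integral_sub (integrable_heaviside p _ E) (integrable_heaviside p _ 0)]
  have hmono : ∀ ω : Config d, spectralSubspace (percLaplacian .neumann ω) 0
      ≤ spectralSubspace (percLaplacian .neumann ω) E :=
    fun ω => spectralSubspace_mono _ (hl0.le.trans hl)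
  have hnonneg : ∀ ω : Config d,
      0 ≤ (inner ℂ (delta 0) (heavisideOp (percLaplacian .neumann ω) E (delta 0))).re
        - (inner ℂ (delta 0) (heavisideOp (percLaplacian .neumann ω) 0 (delta 0))).re := by
    intro ω
    have h := Submodule.starProjection_le_starProjection_iff.2 (hmono ω)
    have := ((ContinuousLinearMap.le_def _ _).1 h).re_inner_nonneg_right (delta 0)
    rw [sub_apply, inner_sub_right] at this
    exact this
  refine const_mul_le_integral ((integrable_heaviside p _ E).sub (integrable_heaviside p _ 0))
    hnonneg (by positivity) fun ω hω => ?_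
  · have hv := neumann_restrictTo hω hb hF
    -- As 0 < l ≤ E, the eigenvector lies in the subspace at E and is orthogonal to the one at 0.
    have h := le_inner_starProjection_sub (hmono ω)
      (mem_spectralSubspace_of_eigenvector (isSelfAdjoint_percLaplacian _ ω) hl hv)
      (fun w hw => inner_eq_zero_of_eigenvector (isSelfAdjoint_percLaplacian _ ω) hl0 hv hw)
      (delta 0)
    exact div_card_le_of_le h0 hF1 h (hnonneg ω)

theorem le_ids_dirichlet {S : Finset (Fin d → ℤ)} {F : (Fin d → ℤ) → ℝ} {l : ℝ}
    (p : unitInterval) (h0 : 0 ∈ S) (hb : ∀ x ∈ S, ∀ y ∈ neighbors x, y ∉ S → F y = -F x)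
    (hF : ∀ x ∈ S, ∑ y ∈ neighbors x, (F x - F y) = l * F x) (hF1 : ∀ x, |F x| ≤ 1)
    {E : ℝ} (hl : l ≤ E) :
    F 0 ^ 2 / S.card * min (p : ℝ) (1 - p) ^ (2 * d * S.card) ≤ ids d p .dirichlet E := by
  have hnonneg : ∀ ω : Config d,
      0 ≤ (inner ℂ (delta 0) (heavisideOp (percLaplacian .dirichlet ω) E (delta 0))).re := fun ω =>
    (ContinuousLinearMap.IsPositive.of_isStarProjection (isStarProjection_starProjection
      (U := spectralSubspace (percLaplacian .dirichlet ω) E))).re_inner_nonneg_right (delta 0)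
  refine const_mul_le_integral (integrable_heaviside p _ E) hnonneg (by positivity) fun ω hω => ?_
  · have hv := dirichlet_restrictTo hω hb hF
    have h := le_inner_starProjection_sub (K := ⊥) bot_le
      (mem_spectralSubspace_of_eigenvector (isSelfAdjoint_percLaplacian _ ω) hl hv)
      (fun w hw => by rw [(Submodule.mem_bot ℂ).1 hw, inner_zero_right]) (delta 0)
    rw [Submodule.starProjection_bot, zero_apply, inner_zero_right,
      Complex.zero_re, sub_zero] at h
    exact div_card_le_of_le h0 hF1 h (hnonneg ω)

end Isolated
-- Product eigenfunctions on boxes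
section Boxes

variable {d : ℕ}

/-- The box `∏ᵢ {0, …, mᵢ - 1}`. -/
def box (m : Fin d → ℕ) : Finset (Fin d → ℤ) := Fintype.piFinset fun i => Finset.Ico 0 (m i : ℤ)

theorem mem_box {m : Fin d → ℕ} {x : Fin d → ℤ} : x ∈ box m ↔ ∀ i, 0 ≤ x i ∧ x i < m i := by
  simp [box]

theorem card_box (m : Fin d → ℕ) : (box m).card = ∏ i, m i := by
  simp [box]

theorem prod_add_single (g : Fin d → ℤ → ℝ) (x : Fin d → ℤ) (i : Fin d) (s : ℤ) :
    ∏ j, g j ((x + Pi.single i s : Fin d → ℤ) j)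
      = g i (x i + s) * ∏ j ∈ Finset.univ.erase i, g j (x j) := by
  rw [← Finset.mul_prod_erase _ _ (Finset.mem_univ i)]
  congr 1
  · simp
  · refine Finset.prod_congr rfl fun j hj => ?_
    simp [Finset.ne_of_mem_erase hj]

/-- Products of one-dimensional eigenfunctions are eigenfunctions. -/
theorem sum_neighbors_prod {g : Fin d → ℤ → ℝ} {l : Fin d → ℝ}
    (hg : ∀ i k, g i (k + 1) + g i (k - 1) = (2 - l i) * g i k) (x : Fin d → ℤ) :
    ∑ y ∈ neighbors x, (∏ i, g i (x i) - ∏ i, g i (y i)) = (∑ i, l i) * ∏ i, g i (x i) := by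
  rw [sum_neighbors, Finset.sum_mul]
  refine Finset.sum_congr rfl fun i _ => ?_
  rw [prod_add_single, prod_add_single, ← Finset.mul_prod_erase _ _ (Finset.mem_univ i)]
  have h := hg i (x i)
  rw [sub_eq_add_neg] at h
  linear_combination (-∏ j ∈ Finset.univ.erase i, g j (x j)) * h

/-- One-dimensional boundary conditions give boundary conditions on a box. -/
theorem prod_eq_of_notMem_box {m : Fin d → ℕ} {g : Fin d → ℤ → ℝ} {σ : ℝ}
    (h0 : ∀ i, g i (-1) = σ * g i 0) (h1 : ∀ i, g i (m i) = σ * g i (m i - 1))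
    {x y : Fin d → ℤ} (hx : x ∈ box m) (hy : y ∈ neighbors x) (hy' : y ∉ box m) :
    ∏ i, g i (y i) = σ * ∏ i, g i (x i) := by
  simp only [neighbors, Finset.mem_image, Finset.mem_product, Finset.mem_univ, true_and,
    Finset.mem_insert, Finset.mem_singleton] at hy
  obtain ⟨⟨i, s⟩, hs, rfl⟩ := hy
  rw [mem_box] at hx hy'
  have hi : ¬ (0 ≤ x i + s ∧ x i + s < m i) := by
    intro h
    refine hy' fun j => ?_
    by_cases hj : j = i
    · subst hj; simpa using h
    · simpa [hj] using hx j
  rw [prod_add_single, ← Finset.mul_prod_erase _ _ (Finset.mem_univ i), ← mul_assoc]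
  congr 1
  have hxi := hx i
  rcases hs with rfl | rfl
  · have e : x i = m i - 1 := by omega
    rw [e, sub_add_cancel, h1]
  · have e : x i = 0 := by omega
    rw [e, zero_add, h0]

end Boxes

/-! ### One-dimensional cosine and sine modes -/

section OneDimensional

/-- The offset 1/2 places the reflection points midway along the boundary edges, at -1/2 and n -
1/2. The cosine is even about both, matching Neumann conditions; the sine of `sin_shift_add` is odd,
matching Dirichlet conditions. -/
theorem cos_shift_add (n : ℕ) (k : ℤ) :
    Real.cos (Real.pi * (((k + 1 : ℤ) : ℝ) + 1 / 2) / n)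
      + Real.cos (Real.pi * (((k - 1 : ℤ) : ℝ) + 1 / 2) / n)
      = (2 - (2 - 2 * Real.cos (Real.pi / n))) * Real.cos (Real.pi * ((k : ℝ) + 1 / 2) / n) := by
  have e1 : Real.pi * (((k + 1 : ℤ) : ℝ) + 1 / 2) / n
      = Real.pi * ((k : ℝ) + 1 / 2) / n + Real.pi / n := by push_cast; ring
  have e2 : Real.pi * (((k - 1 : ℤ) : ℝ) + 1 / 2) / n
      = Real.pi * ((k : ℝ) + 1 / 2) / n - Real.pi / n := by push_cast; ring
  rw [e1, e2, Real.cos_add, Real.cos_sub]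
  ring

theorem sin_shift_add (n : ℕ) (k : ℤ) :
    Real.sin (Real.pi * (((k + 1 : ℤ) : ℝ) + 1 / 2) / n)
      + Real.sin (Real.pi * (((k - 1 : ℤ) : ℝ) + 1 / 2) / n)
      = (2 - (2 - 2 * Real.cos (Real.pi / n))) * Real.sin (Real.pi * ((k : ℝ) + 1 / 2) / n) := by
  have e1 : Real.pi * (((k + 1 : ℤ) : ℝ) + 1 / 2) / n
      = Real.pi * ((k : ℝ) + 1 / 2) / n + Real.pi / n := by push_cast; ring
  have e2 : Real.pi * (((k - 1 : ℤ) : ℝ) + 1 / 2) / n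
      = Real.pi * ((k : ℝ) + 1 / 2) / n - Real.pi / n := by push_cast; ring
  rw [e1, e2, Real.sin_add, Real.sin_sub]
  ring

theorem two_sub_two_cos_le (n : ℕ) :
    2 - 2 * Real.cos (Real.pi / n) ≤ Real.pi ^ 2 / (n : ℝ) ^ 2 := by
  have := Real.one_sub_sq_div_two_le_cos (x := Real.pi / n)
  rw [← div_pow]
  linarith

theorem two_sub_two_cos_pos {n : ℕ} (hn : 1 ≤ n) : 0 < 2 - 2 * Real.cos (Real.pi / n) := by
  have hn' : (1 : ℝ) ≤ n := by exact_mod_cast hn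
  have h := Real.cos_lt_cos_of_nonneg_of_le_pi le_rfl
    (div_le_self Real.pi_pos.le hn') (div_pos Real.pi_pos (by linarith))
  rw [Real.cos_zero] at h
  linarith

end OneDimensional

/-! ### Chains and cubes -/

section LowerBounds

variable {d : ℕ}

/-- The contribution of chains of length `n` to the Neumann integrated density of states. -/
theorem chain_le_ids_neumann_sub (hd : 1 ≤ d) (p : unitInterval) {n : ℕ} (hn : 2 ≤ n) {E : ℝ}
    (hE : Real.pi ^ 2 / (n : ℝ) ^ 2 ≤ E) :
    1 / (n : ℝ) ^ 2 * min (p : ℝ) (1 - p) ^ (2 * d * n)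
      ≤ ids d p .neumann E - ids d p .neumann 0 := by
  have hn' : (2 : ℝ) ≤ n := by exact_mod_cast hn
  have hn0 : (n : ℝ) ≠ 0 := by linarith
  let i₀ : Fin d := ⟨0, hd⟩
  -- The chain is a box of width 1 in every direction but one; there the constant mode satisfies the
  -- Neumann condition with eigenvalue 0.
  let m : Fin d → ℕ := fun i => if i = i₀ then n else 1
  let g : Fin d → ℤ → ℝ := fun i k =>
    if i = i₀ then Real.cos (Real.pi * ((k : ℝ) + 1 / 2) / n) else 1
  let l : Fin d → ℝ := fun i => if i = i₀ then 2 - 2 * Real.cos (Real.pi / n) else 0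
  have hl : ∑ i, l i = 2 - 2 * Real.cos (Real.pi / n) := by simp [l]
  have hcard : (box m).card = n := by rw [card_box]; simp [m]
  have hg : ∀ i k, g i (k + 1) + g i (k - 1) = (2 - l i) * g i k := by
    intro i k
    by_cases hi : i = i₀
    · simp only [g, l, hi, if_true]
      exact cos_shift_add n k
    · simp only [g, l, hi, if_false]
      norm_num
  have hb0 : ∀ i, g i (-1) = 1 * g i 0 := by
    intro i
    by_cases hi : i = i₀
    · simp only [g, hi, if_true, one_mul]
      rw [← Real.cos_neg]
      congr 1; push_cast; ring
    · simp [g, hi]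
  have hb1 : ∀ i, g i (m i) = 1 * g i (m i - 1) := by
    intro i
    by_cases hi : i = i₀
    · simp only [g, m, hi, if_true, one_mul]
      have e1 : Real.pi * (((n : ℤ) : ℝ) + 1 / 2) / n = Real.pi + Real.pi / (2 * n) := by
        push_cast; field_simp
      have e2 : Real.pi * ((((n : ℤ) - 1 : ℤ) : ℝ) + 1 / 2) / n
          = Real.pi - Real.pi / (2 * n) := by
        push_cast; field_simp; ring
      rw [e1, e2, add_comm, Real.cos_add_pi, Real.cos_pi_sub]
    · simp [g, hi]
  have h0 : (0 : Fin d → ℤ) ∈ box m := by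
    rw [mem_box]
    intro i
    by_cases hi : i = i₀
    · simp [m, hi]; omega
    · simp [m, hi]
  have hF0 : ∏ i, g i ((0 : Fin d → ℤ) i) = Real.cos (Real.pi / (2 * n)) := by
    simp only [g, Finset.prod_ite_eq', Finset.mem_univ, if_true, Pi.zero_apply]
    congr 1
    push_cast; field_simp; ring
  have hF1 : ∀ x : Fin d → ℤ, |∏ i, g i (x i)| ≤ 1 := by
    intro x
    simp only [g, Finset.prod_ite_eq', Finset.mem_univ, if_true]
    exact Real.abs_cos_le_one _
  have key := le_ids_neumann_sub (F := fun x => ∏ i, g i (x i)) p h0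
    (fun x hx y hy hy' => by
      simpa using prod_eq_of_notMem_box hb0 hb1 hx hy hy')
    (fun x _ => sum_neighbors_prod hg x) hF1 (E := E)
    (by rw [hl]; exact two_sub_two_cos_pos (by omega))
    (by rw [hl]; exact (two_sub_two_cos_le n).trans hE)
  simp only [hF0, hcard] at key
  refine le_trans (mul_le_mul_of_nonneg_right ?_ ?_) key
  · have hcos : Real.sqrt 2 / 2 ≤ Real.cos (Real.pi / (2 * n)) := by
      rw [← Real.cos_pi_div_four]
      refine Real.cos_le_cos_of_nonneg_of_le_pi (by positivity)
        (by linarith [Real.pi_pos]) ?_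
      exact div_le_div_of_nonneg_left Real.pi_pos.le (by norm_num) (by linarith)
    have hsq : 1 / 2 ≤ Real.cos (Real.pi / (2 * n)) ^ 2 := by
      have := pow_le_pow_left₀ (by positivity) hcos 2
      rw [div_pow, Real.sq_sqrt (by norm_num)] at this
      linarith
    rw [div_le_div_iff₀ (by positivity) (by positivity)]
    nlinarith
  · have := p.2.2
    exact pow_nonneg (le_min p.2.1 (by linarith)) _

/-- The contribution of cubes of side `n` to the Dirichlet integrated density of states. -/
theorem cube_le_ids_dirichlet (p : unitInterval) {n : ℕ} (hn : 1 ≤ n) {E : ℝ}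
    (hE : d * (Real.pi ^ 2 / (n : ℝ) ^ 2) ≤ E) :
    1 / (n : ℝ) ^ (3 * d) * min (p : ℝ) (1 - p) ^ (2 * d * n ^ d) ≤ ids d p .dirichlet E := by
  have hn' : (1 : ℝ) ≤ n := by exact_mod_cast hn
  have hn0 : (n : ℝ) ≠ 0 := by linarith
  let g : Fin d → ℤ → ℝ := fun _ k => Real.sin (Real.pi * ((k : ℝ) + 1 / 2) / n)
  have hg : ∀ i k, g i (k + 1) + g i (k - 1)
      = (2 - (fun _ : Fin d => 2 - 2 * Real.cos (Real.pi / n)) i) * g i k :=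
    fun i k => sin_shift_add n k
  have hl : ∑ _i : Fin d, (2 - 2 * Real.cos (Real.pi / n))
      = d * (2 - 2 * Real.cos (Real.pi / n)) := by
    rw [Finset.sum_const, Finset.card_univ, Fintype.card_fin, nsmul_eq_mul]
  have hcard : (box fun _ : Fin d => n).card = n ^ d := by rw [card_box]; simp
  have hb0 : ∀ i, g i (-1) = -1 * g i 0 := by
    intro i
    simp only [g]
    rw [neg_one_mul, ← Real.sin_neg]
    congr 1; push_cast; ring
  have hb1 : ∀ i, g i n = -1 * g i (n - 1) := by
    intro i
    simp only [g]
    have e1 : Real.pi * (((n : ℤ) : ℝ) + 1 / 2) / n = Real.pi + Real.pi / (2 * n) := by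
      push_cast; field_simp
    have e2 : Real.pi * ((((n : ℤ) - 1 : ℤ) : ℝ) + 1 / 2) / n
        = Real.pi - Real.pi / (2 * n) := by
      push_cast; field_simp; ring
    rw [e1, e2, add_comm, Real.sin_add_pi, Real.sin_pi_sub, neg_one_mul]
  have h0 : (0 : Fin d → ℤ) ∈ box fun _ => n := by
    rw [mem_box]
    intro i
    exact ⟨le_rfl, by simpa using (by omega : 0 < n)⟩
  have hF0 : ∏ i, g i ((0 : Fin d → ℤ) i) = Real.sin (Real.pi / (2 * n)) ^ d := by
    simp only [g, Pi.zero_apply, Finset.prod_const, Finset.card_univ, Fintype.card_fin]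
    congr 2
    push_cast; field_simp; ring
  have hF1 : ∀ x : Fin d → ℤ, |∏ i, g i (x i)| ≤ 1 := by
    intro x
    rw [Finset.abs_prod]
    exact Finset.prod_le_one (fun _ _ => abs_nonneg _) fun _ _ => Real.abs_sin_le_one _
  have key := le_ids_dirichlet (F := fun x => ∏ i, g i (x i)) p h0
    (fun x hx y hy hy' => by
      simpa using prod_eq_of_notMem_box hb0 hb1 hx hy hy')
    (fun x _ => sum_neighbors_prod hg x) hF1 (E := E)
    (by
      rw [hl]
      exact (mul_le_mul_of_nonneg_left (two_sub_two_cos_le n) (Nat.cast_nonneg d)).trans hE)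
  simp only [hF0, hcard] at key
  refine le_trans (mul_le_mul_of_nonneg_right ?_ ?_) key
  · have hsin : 1 / (n : ℝ) ≤ Real.sin (Real.pi / (2 * n)) := by
      have h := Real.mul_le_sin (x := Real.pi / (2 * n)) (by positivity)
        (div_le_div_of_nonneg_left Real.pi_pos.le (by norm_num) (by linarith))
      refine le_trans (le_of_eq ?_) h
      field_simp
    push_cast
    rw [le_div_iff₀ (by positivity), ← pow_mul, mul_comm d 2]
    calc 1 / (n : ℝ) ^ (3 * d) * (n : ℝ) ^ d = (1 / (n : ℝ)) ^ (2 * d) := by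
          rw [one_div_pow, show 3 * d = 2 * d + d by ring, pow_add]
          field_simp
      _ ≤ _ := pow_le_pow_left₀ (by positivity) hsin _
  · have := p.2.2
    exact pow_nonneg (le_min p.2.1 (by linarith)) _

/-- Used to absorb the polynomial prefactors into the exponentials. -/
theorem exp_neg_nat_le {n : ℕ} (hn : 1 ≤ n) : Real.exp (-n) ≤ 1 / n := by
  have hn' : (0 : ℝ) < n := by exact_mod_cast hn
  rw [Real.exp_neg, one_div]
  refine inv_anti₀ hn' ?_
  linarith [Real.add_one_le_exp (n : ℝ)]

end LowerBounds
end BondPercolation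

end

/-! ### The length scale and the constants -/

theorem mainTheorem3 (d : ℕ) (hd : 1 ≤ d) (p : unitInterval) (hp0 : 0 < p) (hp1 : p < 1) :
    ∃ αN αD : ℝ, 0 < αN ∧ 0 < αD ∧ ∀ E : ℝ, 0 < E → E ≤ 4 * d →
      Real.exp (-αN * E ^ (-(1 : ℝ) / 2))
          ≤ BondPercolation.ids d p .neumann E - BondPercolation.ids d p .neumann 0 ∧
      BondPercolation.ids d p .dirichlet E ≤ BondPercolation.ids d p .pseudoDirichlet E ∧
      Real.exp (-αD * E ^ (-(d : ℝ) / 2)) ≤ BondPercolation.ids d p .dirichlet E := by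
  have hp0' : (0 : ℝ) < p := hp0
  have hp1' : (p : ℝ) < 1 := hp1
  have hd' : (1 : ℝ) ≤ d := by exact_mod_cast hd
  set q : ℝ := min (p : ℝ) (1 - p) with hq
  have hq0 : 0 < q := lt_min hp0' (by linarith)
  have hq1 : q ≤ 1 := (min_le_left _ _).trans hp1'.le
  set κ : ℝ := -Real.log q with hκ
  have hκ0 : 0 ≤ κ := neg_nonneg.2 (Real.log_nonpos hq0.le hq1)
  have hqk : ∀ k : ℕ, q ^ k = Real.exp (-(κ * k)) := by
    intro k
    rw [← Real.exp_log hq0, ← Real.exp_nat_mul, hκ]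
    congr 1; ring
  -- The terms 2 and 3d pay for the prefactors n^(-2) and n^(-3d), 2dκ for the isolation
  -- probability; 8d comes from n ≤ 8dr.
  refine ⟨(2 + 2 * d * κ) * (8 * d), (3 * d + 2 * d * κ) * (8 * d) ^ d, by positivity,
    by positivity, fun E hE hE4 => ?_⟩
  -- the length scale
  set r : ℝ := E ^ (-(1 : ℝ) / 2) with hr
  have hr0 : 0 < r := Real.rpow_pos_of_pos hE _
  have hr2 : r ^ 2 = 1 / E := by
    rw [hr, ← Real.rpow_natCast, ← Real.rpow_mul hE.le]
    norm_num [Real.rpow_neg_one]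
  have hrd : E ^ (-(d : ℝ) / 2) = r ^ d := by
    rw [hr, ← Real.rpow_natCast, ← Real.rpow_mul hE.le]
    congr 1; ring
  -- This is where E ≤ 4d enters: it lets the rounding in `n`, less than 2, be absorbed into another
  -- 4dr.
  have hdr : 1 ≤ 2 * d * r := by
    have h1 : 1 ≤ (2 * d * r) ^ 2 := by
      rw [mul_pow, hr2, mul_one_div, le_div_iff₀ hE]
      nlinarith
    nlinarith [mul_pos (show (0 : ℝ) < 2 * d by positivity) hr0]
  -- The lower bound n ≥ 4dr gives dπ²/n² ≤ π²E/(16d) ≤ E, since π < 4 and d ≥ 1; the added 1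
  -- ensures n ≥ 2.
  set n : ℕ := ⌈4 * d * r⌉₊ + 1 with hn
  have hceil : 4 * d * r ≤ (⌈4 * d * r⌉₊ : ℝ) := Nat.le_ceil _
  have hceil' : (⌈4 * d * r⌉₊ : ℝ) < 4 * d * r + 1 := Nat.ceil_lt_add_one (by positivity)
  have hnr : (n : ℝ) ≤ 8 * d * r := by rw [hn]; push_cast; linarith
  have hnl : 4 * d * r ≤ (n : ℝ) := by rw [hn]; push_cast; linarith
  have hn2 : 2 ≤ n := by
    have : 0 < ⌈4 * d * r⌉₊ := Nat.ceil_pos.2 (by positivity)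
    omega
  have hn1 : (1 : ℝ) ≤ n := by exact_mod_cast (by omega : 1 ≤ n)
  have hEd : d * (Real.pi ^ 2 / (n : ℝ) ^ 2) ≤ E := by
    have h1 : (4 * d * r) ^ 2 ≤ (n : ℝ) ^ 2 := pow_le_pow_left₀ (by positivity) hnl 2
    rw [mul_pow, hr2] at h1
    have h2 : Real.pi ^ 2 ≤ 16 := by nlinarith [Real.pi_pos, Real.pi_lt_four]
    have h3 : (4 * (d : ℝ)) ^ 2 ≤ (n : ℝ) ^ 2 * E := by
      have := mul_le_mul_of_nonneg_right h1 hE.le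
      rwa [mul_assoc, one_div_mul_cancel hE.ne', mul_one] at this
    rw [← mul_div_assoc, div_le_iff₀ (by positivity)]
    nlinarith
  have hE1 : Real.pi ^ 2 / (n : ℝ) ^ 2 ≤ E := by
    refine le_trans ?_ hEd
    exact le_mul_of_one_le_left (by positivity) hd'
  have hexp : ∀ k : ℕ, Real.exp (-(k * n)) ≤ 1 / (n : ℝ) ^ k := by
    intro k
    have := pow_le_pow_left₀ (Real.exp_pos _).le
      (BondPercolation.exp_neg_nat_le (n := n) (by omega)) k
    rw [← Real.exp_nat_mul, one_div_pow, mul_neg] at this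
    exact this
  refine ⟨?_, BondPercolation.ids_dirichlet_le p E, ?_⟩
  · refine le_trans ?_ (BondPercolation.chain_le_ids_neumann_sub hd p hn2 hE1)
    rw [← hq, hqk]
    refine le_trans ?_ (mul_le_mul_of_nonneg_right (hexp 2) (Real.exp_pos _).le)
    rw [← Real.exp_add, Real.exp_le_exp]
    push_cast
    have := mul_le_mul_of_nonneg_left hnr (show 0 ≤ 2 + 2 * d * κ by positivity)
    nlinarith
  · refine le_trans ?_ (BondPercolation.cube_le_ids_dirichlet p (by omega) hEd)
    rw [← hq, hqk, hrd]
    refine le_trans ?_ (mul_le_mul_of_nonneg_right (hexp (3 * d)) (Real.exp_pos _).le)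
    rw [← Real.exp_add, Real.exp_le_exp]
    push_cast
    -- The prefactor costs only 3dn in the exponent, which n ≤ n^d puts on the scale of the volume.
    have h1 : (n : ℝ) ≤ (n : ℝ) ^ d := le_self_pow₀ hn1 (by omega)
    have h2 : (n : ℝ) ^ d ≤ (8 * d) ^ d * r ^ d := by
      rw [← mul_pow]
      exact pow_le_pow_left₀ (by positivity) hnr d
    have h3 := mul_le_mul_of_nonneg_left h1 (show 0 ≤ 3 * (d : ℝ) by positivity)
    have h4 := mul_le_mul_of_nonneg_left h2 (show 0 ≤ 3 * d + 2 * d * κ by positivity)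
    linarith
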